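/- Throughout, $\epsilon_c,\epsilon_s,\epsilon_z:\mathbb N\to[0,1]$, $L\in\mathsf{NP}$ is a language with $\mathsf{NP}$ relation $\mathcal R_L$ (decidable in polynomial time, with polynomially long witnesses), $L_n=L\cap\{0,1\}^n$, and PPT means probabilistic polynomial-time. A non-interactive protocol with deterministic verification consists of a PPT algorithm $\mathsf{Gen}$ sampling a reference string $r\leftarrow\mathsf{Gen}(1^n)$, a prover $\pi\leftarrow\mathsf P(x,w;r)$ and a deterministic polynomial-time verifier $\mathsf V(x;r,\pi)\in\{0,1\}$. It is an $(\epsilon_c,\epsilon_s,\epsilon_z)$-NIZK proof for $L$ if * (completeness) for all $x\in L_n$ and $(x,w)\in\mathcal R_L$: $\Pr_{r\leftarrow\mathsf{Gen}(1^n),\,\pi\leftarrow\mathsf P(x,w;r)}[\mathsf V(x;r,\pi)=1]\ge 1-\epsilon_c(n)$; * (soundness) for every prover $\mathsf P^*$ and all $x\in\{0,1\}^n\setminus L_n$: $\Pr_{r\leftarrow\mathsf{Gen}(1^n),\,\pi^*\leftarrow\mathsf P^*(x;r)}[\mathsf V(x;r,\pi^*)=1]\le\epsilon_s(n)$; * (computational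 zero-knowledge) there is a PPT simulator $\mathsf{Sim}$, with $\mathsf{Sim}(x)=\mathsf{Sim}(x;\rho)$ for uniform coins $\rho\in\{0,1\}^{\ell(|x|)}$, such that for every non-uniform PPT distinguisher $D$ and all large enough $n$, for all $x\in L_n$ and $(x,w)\in\mathcal R_L$, the advantage of $D$ in distinguishing $\mathsf{Sim}(x)$ from $(r,\pi)$, where $r\leftarrow\mathsf{Gen}(1^n)$ and $\pi\leftarrow\mathsf P(x,w;r)$, is at most $\epsilon_z(n)$. It is an $(\epsilon_c,\epsilon_s,\epsilon_z)$-NIZK argument if, instead, $\mathsf P$ is PPT and soundness is only required against each PPT prover $\mathsf P^*$, for all large enough $n$. **Lemma.** Suppose $L\in\mathsf{NP}$ has an $(\epsilon_c,\epsilon_s,\epsilon_z)$-NIZK proof or argument with deterministic verification, and let $\mathsf{Sim}$ be a simulator as above, using $\ell(n)$ coins (where $1^n\mapsto 1^{\ell(n)}$ is computable in polynomial time, e.g. $\ell$ a polynomial). For $x\in\{0,1\}^*$ let $f_x(\rho)=(r,\mathsf V(x;r,\pi))$, where $(r,\pi)=\mathsf{Sim}(x;\rho)$. Then the family $\{f_x\}_{x\in\{0,1\}^*}$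 is computable in polynomial time, and there is a polynomial-time (probabilistic) oracle-aided algorithm $R$ such that for every PPT algorithm $\mathcal A$, every polynomial $p$, and all large enough $n\in\mathbb N$: 1. for every $x\in L_n$, if $\mathcal A$ inverts $f_x$ with probability at least $1-1/p(n)$, i.e. $\Pr[\rho'\in\{0,1\}^{\ell(n)}\text{ and }f_x(\rho')=f_x(\rho)]\ge 1-1/p(n)$ for uniform $\rho\in\{0,1\}^{\ell(n)}$ and $\rho'\leftarrow\mathcal A(x,f_x(\rho))$, then $$\Pr[R^{\mathcal A}(x)=1]\ge 1-\epsilon_c(n)-\epsilon_z(n)-\frac1{p(n)};$$ 2. for every $x\in\{0,1\}^n\setminus L_n$, $$\Pr[R^{\mathcal A}(x)=1]\le\epsilon_s(n).$$ Here each query of $R$ to $\mathcal A$ is answered with fresh coins of $\mathcal A$. -/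

import Mathlib

namespace WeakZK

/-- Bit strings, the set `{0,1}^*`. -/
abbrev Str := List Bool

/-- The string `1^n`. -/
def unary (n : ℕ) : Str := List.replicate n true

/-- The uniform distribution on `{0,1}^m`. -/
noncomputable def uniformBits (m : ℕ) : PMF Str :=
  (PMF.uniformOfFintype (Fin m → Bool)).map List.ofFn

/-- The probability that a random bit equals `1`. -/
noncomputable def Pr (p : PMF Bool) : ℝ := (p true).toReal

/-! ### The machine model

Structured programs over finitely many stacks (registers holding bit strings), with a coin-flip
instruction and an oracle instruction. This is a multi-stack (equivalently, multi-tape) Turing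
machine with structured control flow. -/

/-- Programs. Registers are numbered by natural numbers; a program mentions finitely many. -/
inductive Prog : Type
  /-- do nothing -/
  | skip : Prog
  /-- push the bit `b` on register `i` -/
  | push (i : ℕ) (b : Bool) : Prog
  /-- remove the top bit of register `i` (no effect if it is empty) -/
  | pop (i : ℕ) : Prog
  /-- push a fresh uniformly random bit on register `i` -/
  | flip (i : ℕ) : Prog
  /-- query the oracle on the contents of registers `i`, `j`; put the answer in register `k` -/
  | query (i j k : ℕ) : Prog
  /-- first `c`, then `d` -/
  | seq (c d : Prog) : Prog
  /-- inspect register `i`: if it is empty run `e`, if its top bit is `0` run `c₀`, if it is `1`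
  run `c₁` -/
  | cond (i : ℕ) (e c₀ c₁ : Prog) : Prog
  /-- while register `i` is non-empty, run `c` -/
  | loop (i : ℕ) (c : Prog) : Prog

namespace Prog

/-- The program makes no oracle queries. -/
def OracleFree : Prog → Prop
  | query _ _ _ => False
  | seq c d => c.OracleFree ∧ d.OracleFree
  | cond _ e c₀ c₁ => e.OracleFree ∧ c₀.OracleFree ∧ c₁.OracleFree
  | loop _ c => c.OracleFree
  | _ => True

/-- The program flips no coins. -/
def CoinFree : Prog → Prop
  | flip _ => False
  | seq c d => c.CoinFree ∧ d.CoinFree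
  | cond _ e c₀ c₁ => e.CoinFree ∧ c₀.CoinFree ∧ c₁.CoinFree
  | loop _ c => c.CoinFree
  | _ => True

end Prog

/-- The contents of all registers. -/
abbrev Regs := ℕ → Str

/-- A (possibly randomized) oracle, taking two strings. Every query is answered with fresh
randomness, independent of everything else. A deterministic oracle is one with values of the form
`PMF.pure y`. -/
abbrev Oracle := Str → Str → PMF Str

/-- A configuration: the commands still to be executed (first one first), the registers, and the
time spent so far. The machine has halted when there is nothing left to execute. -/
structure Config where
  todo : List Prog
  regs : Regs
  time : ℕ

/-- Execute one instruction. Everything costs one unit of time, except that an oracle query is also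
charged the length of the query, as if it had been written out on a query tape. -/
noncomputable def step (O : Oracle) : Config → PMF Config
  | ⟨[], s, t⟩ => PMF.pure ⟨[], s, t⟩
  | ⟨.skip :: K, s, t⟩ => PMF.pure ⟨K, s, t + 1⟩
  | ⟨.push i b :: K, s, t⟩ => PMF.pure ⟨K, Function.update s i (b :: s i), t + 1⟩
  | ⟨.pop i :: K, s, t⟩ => PMF.pure ⟨K, Function.update s i (s i).tail, t + 1⟩
  | ⟨.flip i :: K, s, t⟩ =>
      (PMF.uniformOfFintype Bool).bind fun b =>
        PMF.pure ⟨K, Function.update s i (b :: s i), t + 1⟩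
  | ⟨.query i j k :: K, s, t⟩ =>
      (O (s i) (s j)).bind fun y =>
        PMF.pure ⟨K, Function.update s k y, t + 1 + ((s i).length + (s j).length)⟩
  | ⟨.seq c d :: K, s, t⟩ => PMF.pure ⟨c :: d :: K, s, t + 1⟩
  | ⟨.cond i e c₀ c₁ :: K, s, t⟩ =>
      PMF.pure (match s i with
        | [] => ⟨e :: K, s, t + 1⟩
        | false :: _ => ⟨c₀ :: K, s, t + 1⟩
        | true :: _ => ⟨c₁ :: K, s, t + 1⟩)
  | ⟨.loop i c :: K, s, t⟩ =>
      PMF.pure (match s i with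
        | [] => ⟨K, s, t + 1⟩
        | _ :: _ => ⟨c :: .loop i c :: K, s, t + 1⟩)

/-- Execute `m` instructions (or fewer, if the machine halts before). -/
noncomputable def run (O : Oracle) : ℕ → Config → PMF Config
  | 0, γ => PMF.pure γ
  | m + 1, γ => (step O γ).bind (run O m)

/-- The initial configuration: the `k` inputs are in registers `0, …, k - 1`, all other registers
are empty. -/
def start (c : Prog) {k : ℕ} (a : Fin k → Str) : Config :=
  ⟨[c], fun i => if h : i < k then a ⟨i, h⟩ else [], 0⟩

/-- Reading a string as the result of a computation: the content of register `0`. -/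
def outStr (s : Regs) : Str := s 0

/-- Reading a pair of strings: registers `0` and `1`. -/
def outPair (s : Regs) : Str × Str := (s 0, s 1)

/-- Reading a bit: `1` (accept) if register `0` holds the string `1`, and `0` otherwise. -/
def outBit (s : Regs) : Bool := decide (s 0 = [true])

/-- On input `a` and with oracle `O`, the program `c` halts within time `T`, whatever the coins and
the oracle answers are, and its result (read by `out`) has distribution `μ`. -/
def Prog.OutputsWithin {β : Type} (out : Regs → β) (c : Prog) (O : Oracle) {k : ℕ}
    (a : Fin k → Str) (T : ℕ) (μ : PMF β) : Prop :=
  (∀ γ ∈ (run O T (start c a)).support, γ.todo = [] ∧ γ.time ≤ T) ∧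
    (run O T (start c a)).map (fun γ => out γ.regs) = μ

/-- The total length of the inputs. -/
def inputLength {k : ℕ} (a : Fin k → Str) : ℕ := ∑ i, (a i).length

/-- `f` is computed by a deterministic algorithm in time polynomial in the input length. -/
def IsPolyTime {β : Type} (out : Regs → β) {k : ℕ} (f : (Fin k → Str) → β) : Prop :=
  ∃ (c : Prog) (q : Polynomial ℕ), c.OracleFree ∧ c.CoinFree ∧
    ∀ (O : Oracle) (a : Fin k → Str),
      c.OutputsWithin out O a (q.eval (inputLength a)) (PMF.pure (f a))

/-- `F a` is the output distribution, on input `a`, of a probabilistic algorithm that runs in time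
polynomial in the input length. -/
def IsPPT {β : Type} (out : Regs → β) {k : ℕ} (F : (Fin k → Str) → PMF β) : Prop :=
  ∃ (c : Prog) (q : Polynomial ℕ), c.OracleFree ∧
    ∀ (O : Oracle) (a : Fin k → Str), c.OutputsWithin out O a (q.eval (inputLength a)) (F a)

/-- `R O x` is the output distribution, on input `x` and with access to `O`, of a (probabilistic)
oracle-aided algorithm whose running time is polynomial in the length of `x`, for every oracle. -/
def IsPolyTimeOracleAlg (R : Oracle → Str → PMF Bool) : Prop :=
  ∃ (c : Prog) (q : Polynomial ℕ), ∀ (O : Oracle) (x : Str),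
    c.OutputsWithin outBit O ![x] (q.eval x.length) (R O x)

/-! ### NP and computational indistinguishability -/

/-- `Rel` is an NP relation for the language `L`: it is decidable in polynomial time, witnesses have
polynomial length, and `L` is the set of strings that have a witness. So `L ∈ NP` iff such a `Rel`
exists. -/
def IsNPRelation (L : Set Str) (Rel : Str → Str → Bool) : Prop :=
  IsPolyTime outBit (fun a : Fin 2 → Str => Rel (a 0) (a 1)) ∧
  (∃ q : Polynomial ℕ, ∀ x w, Rel x w = true → w.length ≤ q.eval x.length) ∧
  ∀ x, x ∈ L ↔ ∃ w, Rel x w = true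

/-- `Δ_c(X; Y) ≤ ε`, for families of distributions on pairs of strings indexed by `ι`, the index `i`
having size `size i`: for every non-uniform PPT distinguisher (a PPT algorithm `D` with an advice
string of polynomial length for each size), the distinguishing advantage is at most `ε n` for all
indices of size `n`, for all large enough `n`. Equivalently: for every choice of one index of each
size, the resulting ensembles indexed by `n` are `ε`-computationally indistinguishable. -/
def CompIndist {ι : Type} (size : ι → ℕ) (X Y : ι → PMF (Str × Str)) (ε : ℕ → ℝ) : Prop :=
  ∀ D : Str → Str × Str → PMF Bool,
    IsPPT outBit (fun a : Fin 3 → Str => D (a 0) (a 1, a 2)) →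
    ∀ advice : ℕ → Str,
      (∃ q : Polynomial ℕ, ∀ n, (advice n).length ≤ q.eval n) →
      ∃ n₀ : ℕ, ∀ n ≥ n₀, ∀ i, size i = n →
        |Pr ((X i).bind (D (advice n))) - Pr ((Y i).bind (D (advice n)))| ≤ ε n

/-! ### Non-interactive zero-knowledge -/

/-- The algorithms of a non-interactive protocol with deterministic verification. -/
structure NIProtocol where
  /-- samples the common reference string, on input `1^n` -/
  Gen : Str → PMF Str
  /-- the honest prover `P(x, w; r)` -/
  P : Str → Str → Str → PMF Str
  /-- the verifier `V(x; r, π)` -/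
  V : Str → Str → Str → Bool
  gen_ppt : IsPPT outStr (fun a : Fin 1 → Str => Gen (a 0))
  v_polyTime : IsPolyTime outBit (fun a : Fin 3 → Str => V (a 0) (a 1) (a 2))

namespace NIProtocol

variable (Z : NIProtocol)

/-- The view of the verifier: the reference string and the prover's message. -/
noncomputable def view (x w : Str) : PMF (Str × Str) :=
  (Z.Gen (unary x.length)).bind fun r => (Z.P x w r).map fun π => (r, π)

/-- Does `V` accept on input `x` when the (arbitrary) prover `Q` sends the message? -/
noncomputable def verdict (Q : Str → Str → PMF Str) (x : Str) : PMF Bool :=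
  (Z.Gen (unary x.length)).bind fun r => (Q x r).map fun π => Z.V x r π

/-- Completeness with error `εc`. -/
def Complete (Rel : Str → Str → Bool) (εc : ℕ → ℝ) : Prop :=
  ∀ x w, Rel x w = true → 1 - εc x.length ≤ Pr (Z.verdict (fun x r => Z.P x w r) x)

/-- Statistical soundness with error `εs`: against all provers. -/
def StatSound (L : Set Str) (εs : ℕ → ℝ) : Prop :=
  ∀ Q : Str → Str → PMF Str, ∀ x ∉ L, Pr (Z.verdict Q x) ≤ εs x.length

/-- Computational soundness with error `εs`: against all PPT provers, for large enough inputs. -/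
def CompSound (L : Set Str) (εs : ℕ → ℝ) : Prop :=
  ∀ Q : Str → Str → PMF Str, IsPPT outStr (fun a : Fin 2 → Str => Q (a 0) (a 1)) →
    ∃ n₀ : ℕ, ∀ n ≥ n₀, ∀ x ∉ L, x.length = n → Pr (Z.verdict Q x) ≤ εs n

end NIProtocol

/-- A probabilistic polynomial-time simulator, with its coins made explicit: on input `x` it draws
`ρ` uniformly from `{0,1}^ℓ(|x|)` and outputs the pair `(r, π) = sim x ρ`. The number of coins `ℓ`
can be any function such that `1^n ↦ 1^ℓ(n)` is computable in polynomial time (for example any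
polynomial). -/
structure Simulator where
  ℓ : ℕ → ℕ
  sim : Str → Str → Str × Str
  ℓ_polyTime : IsPolyTime outStr (fun a : Fin 1 → Str => unary (ℓ (a 0).length))
  sim_polyTime : IsPolyTime outPair (fun a : Fin 2 → Str => sim (a 0) (a 1))

namespace Simulator

/-- The output distribution `Sim(x)`. -/
noncomputable def dist (S : Simulator) (x : Str) : PMF (Str × Str) :=
  (uniformBits (S.ℓ x.length)).map (S.sim x)

/-- `S` simulates the view of the verifier in the protocol `Z`, with error `εz`. -/
def ZeroKnowledge (S : Simulator) (Z : NIProtocol) (Rel : Str → Str → Bool) (εz : ℕ → ℝ) : Prop :=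
  CompIndist (ι := {xw : Str × Str // Rel xw.1 xw.2 = true}) (fun i => i.1.1.length)
    (fun i => S.dist i.1.1) (fun i => Z.view i.1.1 i.1.2) εz

end Simulator

/-- `Z` is an `(εc, εs, εz)`-NIZK proof for the language `L` with NP relation `Rel`. -/
def IsNIZKProof (Z : NIProtocol) (L : Set Str) (Rel : Str → Str → Bool) (εc εs εz : ℕ → ℝ) :
    Prop :=
  Z.Complete Rel εc ∧ Z.StatSound L εs ∧ ∃ S : Simulator, S.ZeroKnowledge Z Rel εz

/-- `Z` is an `(εc, εs, εz)`-NIZK argument for the language `L` with NP relation `Rel`: the honest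
prover is efficient, and soundness is only required against efficient provers. -/
def IsNIZKArgument (Z : NIProtocol) (L : Set Str) (Rel : Str → Str → Bool) (εc εs εz : ℕ → ℝ) :
    Prop :=
  IsPPT outStr (fun a : Fin 3 → Str => Z.P (a 0) (a 1) (a 2)) ∧
  Z.Complete Rel εc ∧ Z.CompSound L εs ∧ ∃ S : Simulator, S.ZeroKnowledge Z Rel εz

/-! ### Inverting a function family -/

/-- Does `A` invert `f_x : {0,1}^m → {0,1}^*` (where `f_x = F x`)? Draw a uniform `ρ ∈ {0,1}^m`, run
`A` on `x` and `f_x(ρ)`, and check that its output is a preimage of `f_x(ρ)` in `{0,1}^m`. -/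
noncomputable def inverts (F : Str → Str → Str) (m : ℕ) (A : Str → Str → PMF Str) (x : Str) :
    PMF Bool :=
  (uniformBits m).bind fun ρ =>
    (A x (F x ρ)).map fun ρ' => decide (ρ'.length = m ∧ F x ρ' = F x ρ)

end WeakZK

open WeakZK

/-!
The algorithm `R` samples a reference string `r` itself, asks the inverter for coins `ρ` with
`f_x(ρ) = (r, 1)`, and accepts if the answer is such a preimage.

* If `x ∉ L`: a preimage of `(r, 1)` contains a proof that makes the verifier accept with the
  reference string `r`. So the prover that runs the inverter and simulates with the coins it finds
  is accepted at least as often as `R` accepts, and `R` inherits the soundness error.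
* If `x ∈ L`: whether the inverter succeeds at the value of `f_x` given by a view `(r, π)` can be
  tested efficiently, and on simulated views this test succeeds as often as the inverter inverts
  `f_x`. By zero-knowledge the same holds for real views, up to `εz`. By completeness the verdict on
  a real view is `1`, except with probability `εc`, and then the test is the one performed by `R`.

That `R`, the prover and the test run in polynomial time rests on the closure of polynomial-time
algorithms under composition: renaming the registers of a program commutes with its execution, so a
program can be run as a subroutine on registers of its own.
-/

namespace WeakZK

/-! ### Big-step semantics -/

section Execution

variable {O : Oracle} {D D' : ℕ} {γ : Config} {μ : PMF Regs}

/-- Big-step semantics: from `γ` the machine halts by the time `D`, whatever the coins and the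
oracle answers are, and the final contents of the registers have distribution `μ`. One step is
described by a sample space `α` and an outcome map `f`, so that derivations can be transported along
maps of configurations. -/
inductive Halts (O : Oracle) (D : ℕ) : Config → PMF Regs → Prop
  | done {s : Regs} {t : ℕ} (ht : t ≤ D) : Halts O D ⟨[], s, t⟩ (PMF.pure s)
  | next {α : Type} {γ : Config} {p : PMF α} {f : α → Config} {ν : α → PMF Regs}
      (hγ : γ.todo ≠ []) (hf : step O γ = p.map f) (h : ∀ a ∈ p.support, Halts O D (f a) (ν a)) :
      Halts O D γ (p.bind ν)

theorem Halts.of_pure_step {γ₁ : Config} (hγ : γ.todo ≠ []) (hs : step O γ = PMF.pure γ₁)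
    (h : Halts O D γ₁ μ) : Halts O D γ μ := by
  simpa using Halts.next (p := PMF.pure ()) (f := fun _ => γ₁) (ν := fun _ => μ) hγ
    (by rw [hs, PMF.pure_map]) (fun _ _ => h)

theorem Halts.simulate {φ : Config → Config} {ν : Regs → PMF Regs}
    (hφ : ∀ γ, γ.todo ≠ [] → (φ γ).todo ≠ [] ∧ step O (φ γ) = (step O γ).map φ)
    (h : Halts O D γ μ) (hν : ∀ s ∈ μ.support, ∀ t ≤ D, Halts O D' (φ ⟨[], s, t⟩) (ν s)) :
    Halts O D' (φ γ) (μ.bind ν) := by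
  induction h with
  | done ht => simpa using hν _ (by simp) _ ht
  | next hγ hf _ ih =>
    rw [PMF.bind_bind]
    refine Halts.next (hφ _ hγ).1 (by rw [(hφ _ hγ).2, hf, PMF.map_comp]) fun a ha => ?_
    exact ih a ha fun s hs => hν s ((PMF.mem_support_bind_iff _ _ _).2 ⟨a, ha, hs⟩)

theorem Halts.mono (h : Halts O D γ μ) (hD : D ≤ D') : Halts O D' γ μ := by
  simpa using h.simulate (φ := id) (ν := PMF.pure)
    (fun _ hγ => ⟨hγ, by rw [PMF.map_id, id]⟩) fun _ _ _ ht => .done (ht.trans hD)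

theorem step_append (O : Oracle) (K : List Prog) (d : ℕ) (hγ : γ.todo ≠ []) :
    step O ⟨γ.todo ++ K, γ.regs, γ.time + d⟩ =
      (step O γ).map fun γ => ⟨γ.todo ++ K, γ.regs, γ.time + d⟩ := by
  obtain ⟨_ | ⟨c, L⟩, s, t⟩ := γ
  · exact absurd rfl hγ
  cases c with
  | cond i c c₀ c₁ =>
    rcases h : s i with _ | ⟨_ | _, l⟩ <;> simp [step, PMF.pure_map, h, add_right_comm]
  | loop i c => rcases h : s i with _ | ⟨b, l⟩ <;> simp [step, PMF.pure_map, h, add_right_comm]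
  | _ => simp [step, PMF.map_bind, PMF.pure_map, add_right_comm]

theorem Halts.append {K : List Prog} {d : ℕ} {ν : Regs → PMF Regs} (h : Halts O D γ μ)
    (hν : ∀ s ∈ μ.support, ∀ t ≤ D, Halts O D' ⟨K, s, t + d⟩ (ν s)) :
    Halts O D' ⟨γ.todo ++ K, γ.regs, γ.time + d⟩ (μ.bind ν) :=
  h.simulate (φ := fun γ => ⟨γ.todo ++ K, γ.regs, γ.time + d⟩)
    (fun _ hγ => ⟨by simp [hγ], step_append O K d hγ⟩) hν

theorem time_lt_of_mem_support_step {γ₁ : Config} (hγ : γ.todo ≠ []) (h : γ₁ ∈ (step O γ).support) :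
    γ.time < γ₁.time := by
  obtain ⟨_ | ⟨c, K⟩, s, t⟩ := γ
  · exact absurd rfl hγ
  cases c with
  | cond i c c₀ c₁ => rcases hi : s i with _ | ⟨_ | _, l⟩ <;> simp_all [step]
  | loop i c => rcases hi : s i with _ | ⟨b, l⟩ <;> simp_all [step]
  | query i j k =>
    simp only [step, PMF.mem_support_bind_iff, PMF.mem_support_pure_iff] at h
    obtain ⟨y, -, rfl⟩ := h
    simp only
    omega
  | flip i =>
    simp only [step, PMF.mem_support_bind_iff, PMF.mem_support_pure_iff] at h
    obtain ⟨b, -, rfl⟩ := h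
    simp
  | _ => simp_all [step]

theorem Halts.time_le (h : Halts O D γ μ) : γ.time ≤ D := by
  induction h with
  | done ht => exact ht
  | @next α γ p f _ hγ hf _ ih =>
    obtain ⟨a, ha⟩ := p.support_nonempty
    have := time_lt_of_mem_support_step hγ (γ₁ := f a)
      (hf ▸ (PMF.mem_support_map_iff _ _ _).2 ⟨a, ha, rfl⟩)
    exact this.le.trans (ih a ha)

theorem bind_congr_support {α β : Type} (p : PMF α) {f g : α → PMF β}
    (h : ∀ a ∈ p.support, f a = g a) : p.bind f = p.bind g := by
  ext b
  simp only [PMF.bind_apply]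
  refine tsum_congr fun a => ?_
  by_cases ha : a ∈ p.support
  · rw [h a ha]
  · rw [(PMF.apply_eq_zero_iff p a).2 ha, zero_mul, zero_mul]

theorem run_nil (O : Oracle) (N : ℕ) (s : Regs) (t : ℕ) :
    run O N ⟨[], s, t⟩ = PMF.pure ⟨[], s, t⟩ := by
  induction N with
  | zero => rfl
  | succ N ih => simp [run, step, ih]

theorem Halts.run_eq (h : Halts O D γ μ) {N : ℕ} (hN : D ≤ γ.time + N) :
    (∀ γ' ∈ (run O N γ).support, γ'.todo = [] ∧ γ'.time ≤ D) ∧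
      (run O N γ).map Config.regs = μ := by
  induction h generalizing N with
  | done ht => simpa [run_nil, PMF.pure_map] using ht
  | @next α γ p f ν hγ hf h ih =>
    have htime : ∀ a ∈ p.support, γ.time < (f a).time := fun a ha =>
      time_lt_of_mem_support_step hγ (hf ▸ (PMF.mem_support_map_iff _ _ _).2 ⟨a, ha, rfl⟩)
    obtain ⟨a₀, ha₀⟩ := p.support_nonempty
    have := htime a₀ ha₀
    have := (h a₀ ha₀).time_le
    obtain ⟨N, rfl⟩ : ∃ M, N = M + 1 := ⟨N - 1, by omega⟩
    have ih' := fun a ha => ih a ha (N := N) (by have := htime a ha; omega)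
    rw [run, hf, PMF.bind_map, PMF.map_bind]
    refine ⟨fun γ' hγ' => ?_, bind_congr_support _ fun a ha => (ih' a ha).2⟩
    obtain ⟨a, ha, hγ'⟩ := (PMF.mem_support_bind_iff _ _ _).1 hγ'
    exact (ih' a ha).1 γ' hγ'

theorem halts_of_run {N : ℕ} (h : ∀ γ' ∈ (run O N γ).support, γ'.todo = [] ∧ γ'.time ≤ D) :
    Halts O D γ ((run O N γ).map Config.regs) := by
  induction N generalizing γ with
  | zero =>
    obtain ⟨K, s, t⟩ := γ
    obtain ⟨rfl, ht⟩ : K = [] ∧ t ≤ D := by simpa [run] using h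
    simpa [run, PMF.pure_map] using Halts.done ht
  | succ N ih =>
    obtain ⟨_ | ⟨c, K⟩, s, t⟩ := γ
    · rw [run_nil] at h ⊢
      simpa [PMF.pure_map] using Halts.done (by simpa using h)
    · rw [run, PMF.map_bind]
      refine .next (f := id) (by simp) (PMF.map_id _).symm fun γ₁ hγ₁ => ih fun γ' hγ' => h γ' ?_
      exact (PMF.mem_support_bind_iff _ _ _).2 ⟨γ₁, hγ₁, hγ'⟩

theorem length_add_time_le_of_step {γ₁ : Config} (hγ : ∀ c ∈ γ.todo, c.OracleFree)
    (h : γ₁ ∈ (step O γ).support) :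
    (∀ c ∈ γ₁.todo, c.OracleFree) ∧
      ∀ i, (γ₁.regs i).length + γ.time ≤ (γ.regs i).length + γ₁.time := by
  obtain ⟨_ | ⟨c, K⟩, s, t⟩ := γ
  · obtain rfl : γ₁ = _ := by simpa [step] using h
    exact ⟨hγ, fun i => le_rfl⟩
  obtain ⟨hc, hK⟩ := List.forall_mem_cons.1 hγ
  have hupdate (j : ℕ) (v : Str) (hv : v.length ≤ (s j).length + 1) (i : ℕ) :
      (Function.update s j v i).length + t ≤ (s i).length + (t + 1) := by
    rcases eq_or_ne i j with rfl | hi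
    · simp only [Function.update_self]; omega
    · simp only [Function.update_of_ne hi]; omega
  cases c with
  | query i j k => exact hc.elim
  | cond j c c₀ c₁ =>
    rcases hj : s j with _ | ⟨_ | _, l⟩ <;> simp_all [step, Prog.OracleFree]
  | loop j c =>
    rcases hj : s j with _ | ⟨b, l⟩ <;> simp_all [step, Prog.OracleFree]
  | flip j =>
    simp only [step, PMF.mem_support_bind_iff, PMF.mem_support_pure_iff] at h
    obtain ⟨b, -, rfl⟩ := h
    exact ⟨hK, hupdate _ _ (by simp)⟩
  | push j b =>
    obtain rfl : γ₁ = _ := by simpa [step] using h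
    exact ⟨hK, hupdate _ _ (by simp)⟩
  | pop j =>
    obtain rfl : γ₁ = _ := by simpa [step] using h
    exact ⟨hK, hupdate _ _ (by rw [List.length_tail]; omega)⟩
  | _ =>
    obtain rfl : γ₁ = _ := by simpa [step] using h
    simp_all [Prog.OracleFree]

/-- Only an oracle answer can lengthen a register by more than the time it takes. -/
theorem Halts.length_add_time_le (h : Halts O D γ μ) (hγ : ∀ c ∈ γ.todo, c.OracleFree) {s : Regs}
    (hs : s ∈ μ.support) (i : ℕ) : (s i).length + γ.time ≤ (γ.regs i).length + D := by
  induction h with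
  | done ht =>
    obtain rfl := (PMF.mem_support_pure_iff _ _).1 hs
    simpa using ht
  | next _ hf _ ih =>
    obtain ⟨a, ha, hs⟩ := (PMF.mem_support_bind_iff _ _ _).1 hs
    obtain ⟨h₁, h₂⟩ := length_add_time_le_of_step hγ
      (hf ▸ (PMF.mem_support_map_iff _ _ _).2 ⟨a, ha, rfl⟩)
    have := ih a ha h₁ hs
    have := h₂ i
    omega

end Execution

/-- The big-step judgement for programs: from registers `s`, the program `c` takes time at most `T`
and leaves the registers distributed according to `μ`. -/
def Exec (O : Oracle) (c : Prog) (s : Regs) (T : ℕ) (μ : PMF Regs) : Prop :=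
  Halts O T ⟨[c], s, 0⟩ μ

/-- The registers at the start of a computation on the inputs `a`. -/
def startRegs {k : ℕ} (a : Fin k → Str) : Regs := fun i => if h : i < k then a ⟨i, h⟩ else []

section ExecRules

variable {O : Oracle} {c d : Prog} {s s₁ : Regs} {T T' i : ℕ} {μ : PMF Regs}

theorem outputsWithin_iff {β : Type} {out : Regs → β} {k : ℕ} {a : Fin k → Str} {μ : PMF β} :
    c.OutputsWithin out O a T μ ↔ ∃ ν, Exec O c (startRegs a) T ν ∧ ν.map out = μ := by
  constructor
  · rintro ⟨h, rfl⟩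
    exact ⟨_, halts_of_run h, PMF.map_comp _ _ _⟩
  · rintro ⟨ν, h, rfl⟩
    obtain ⟨hhalt, rfl⟩ := Halts.run_eq h (N := T) (by simp)
    exact ⟨hhalt, (PMF.map_comp _ _ _).symm⟩

theorem Prog.OutputsWithin.mono {β : Type} {out : Regs → β} {k : ℕ} {a : Fin k → Str} {μ : PMF β}
    (h : c.OutputsWithin out O a T μ) (hT : T ≤ T') : c.OutputsWithin out O a T' μ := by
  obtain ⟨ν, hν, hμ⟩ := outputsWithin_iff.1 h
  exact outputsWithin_iff.2 ⟨ν, Halts.mono hν hT, hμ⟩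

theorem Exec.mono (h : Exec O c s T μ) (hT : T ≤ T') : Exec O c s T' μ :=
  Halts.mono h hT

theorem Exec.halts_cons {D t : ℕ} {K : List Prog} {ν : Regs → PMF Regs} (h : Exec O c s T μ)
    (hν : ∀ s' ∈ μ.support, ∀ t' ≤ t + T, Halts O D ⟨K, s', t'⟩ (ν s')) :
    Halts O D ⟨c :: K, s, t⟩ (μ.bind ν) := by
  simpa using Halts.append (d := t) h fun s' hs' t' ht' => hν s' hs' _ (by omega)

theorem Exec.halts_singleton {D t : ℕ} (h : Exec O c s T μ) (hD : t + T ≤ D) :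
    Halts O D ⟨[c], s, t⟩ μ := by
  simpa using h.halts_cons (ν := PMF.pure) fun _ _ _ ht' => .done (ht'.trans hD)

theorem exec_of_step (h : step O ⟨[c], s, 0⟩ = PMF.pure ⟨[], s₁, 1⟩) :
    Exec O c s 1 (PMF.pure s₁) :=
  .of_pure_step (by simp) h (.done le_rfl)

theorem Exec.of_unfold (h : step O ⟨[c], s, 0⟩ = PMF.pure ⟨[d], s, 1⟩) (hd : Exec O d s T μ) :
    Exec O c s (T + 1) μ :=
  Halts.of_pure_step (by simp) h (hd.halts_singleton (add_comm 1 T).le)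

theorem exec_skip (O : Oracle) (s : Regs) : Exec O .skip s 1 (PMF.pure s) :=
  exec_of_step rfl

theorem exec_push (O : Oracle) (s : Regs) (i : ℕ) (b : Bool) :
    Exec O (.push i b) s 1 (PMF.pure (Function.update s i (b :: s i))) :=
  exec_of_step rfl

theorem exec_pop (O : Oracle) (s : Regs) (i : ℕ) :
    Exec O (.pop i) s 1 (PMF.pure (Function.update s i (s i).tail)) :=
  exec_of_step rfl

theorem exec_query (O : Oracle) (s : Regs) (i j k : ℕ) :
    Exec O (.query i j k) s (1 + ((s i).length + (s j).length))
      ((O (s i) (s j)).map (Function.update s k)) :=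
  .next (by simp) (by simp only [step, zero_add]; rfl) fun _ _ => .done le_rfl

theorem Exec.seq {ξ : Regs → PMF Regs} (hc : Exec O c s T μ)
    (hd : ∀ s' ∈ μ.support, Exec O d s' T' (ξ s')) :
    Exec O (.seq c d) s (T + T' + 1) (μ.bind ξ) :=
  Halts.of_pure_step (by simp) rfl (hc.halts_cons fun s' hs' _ _ =>
    (hd s' hs').halts_singleton (by omega))

theorem Exec.seq_pure (hc : Exec O c s T (PMF.pure s₁)) (hd : Exec O d s₁ T' μ) :
    Exec O (.seq c d) s (T + T' + 1) μ := by
  simpa using hc.seq (ξ := fun _ => μ) (by simpa using hd)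

theorem Exec.exists_seq {β : Type} {f : Regs → β} {F : Regs → PMF β} (hc : Exec O c s T μ)
    (hd : ∀ s' ∈ μ.support, ∃ ξ, Exec O d s' T' ξ ∧ ξ.map f = F s') :
    ∃ ξ, Exec O (.seq c d) s (T + T' + 1) ξ ∧ ξ.map f = μ.bind F := by
  choose! ξ hξ hF using hd
  exact ⟨_, hc.seq hξ, by rw [PMF.map_bind]; exact bind_congr_support _ hF⟩

theorem Exec.cond_nil {c₀ c₁ : Prog} (hs : s i = []) (h : Exec O c s T μ) :
    Exec O (.cond i c c₀ c₁) s (T + 1) μ :=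
  h.of_unfold (by simp [step, hs])

theorem Exec.cond_cons {c₀ c₁ : Prog} {b : Bool} {u : Str} (hs : s i = b :: u)
    (h : Exec O (bif b then c₁ else c₀) s T μ) : Exec O (.cond i c c₀ c₁) s (T + 1) μ :=
  h.of_unfold (by cases b <;> simp [step, hs])

theorem exec_loop_nil (hs : s i = []) : Exec O (.loop i c) s 1 (PMF.pure s) :=
  exec_of_step (by simp [step, hs])

theorem Exec.loop_cons (hs : s i ≠ []) (hc : Exec O c s T (PMF.pure s₁))
    (hl : Exec O (.loop i c) s₁ T' μ) : Exec O (.loop i c) s (T + T' + 1) μ := by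
  obtain ⟨b, u, hu⟩ := List.exists_cons_of_ne_nil hs
  refine Halts.of_pure_step (γ₁ := ⟨[c, .loop i c], s, 1⟩) (by simp) (by simp [step, hu]) ?_
  simpa only [PMF.pure_bind] using hc.halts_cons (ν := fun _ => μ) fun s' hs' _ _ => by
    obtain rfl := (PMF.mem_support_pure_iff _ _).1 hs'
    exact hl.halts_singleton (by omega)

/-- The Hoare rule for loops which consume the register they test one bit at a time. -/
theorem exec_loop {I : Regs → Prop} (hc : ∀ s, I s → s i ≠ [] →
      ∃ s₁, I s₁ ∧ s₁ i = (s i).tail ∧ Exec O c s T (PMF.pure s₁)) (hs : I s) :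
    ∃ s', I s' ∧ s' i = [] ∧ Exec O (.loop i c) s ((s i).length * (T + 1) + 1) (PMF.pure s') := by
  induction hu : s i generalizing s with
  | nil => exact ⟨s, hs, hu, (exec_loop_nil hu).mono (by simp)⟩
  | cons b u ih =>
    obtain ⟨s₁, hs₁, htail, h₁⟩ := hc s hs (by simp [hu])
    obtain ⟨s', hs', hnil, h'⟩ := ih hs₁ (by simpa [hu] using htail)
    refine ⟨s', hs', hnil, (h₁.loop_cons (by simp [hu]) h').mono ?_⟩
    rw [List.length_cons]
    linarith

theorem Exec.length_le (h : Exec O c s T μ) (hc : c.OracleFree) (hs : s₁ ∈ μ.support) (i : ℕ) :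
    (s₁ i).length ≤ (s i).length + T :=
  Halts.length_add_time_le h (by simpa using hc) hs i

end ExecRules

section Rename

variable {e : ℕ → ℕ}

/-- Rename the registers of a program. -/
def Prog.rename (e : ℕ → ℕ) : Prog → Prog
  | .skip => .skip
  | .push i b => .push (e i) b
  | .pop i => .pop (e i)
  | .flip i => .flip (e i)
  | .query i j k => .query (e i) (e j) (e k)
  | .seq c d => .seq (c.rename e) (d.rename e)
  | .cond i c c₀ c₁ => .cond (e i) (c.rename e) (c₀.rename e) (c₁.rename e)
  | .loop i c => .loop (e i) (c.rename e)

theorem extend_update (he : e.Injective) (u s : Regs) (i : ℕ) (v : Str) :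
    Function.extend e (Function.update u i v) s =
      Function.update (Function.extend e u s) (e i) v := by
  funext j
  by_cases hj : ∃ l, e l = j
  · obtain ⟨l, rfl⟩ := hj
    rw [he.extend_apply, Function.update_apply, Function.update_apply, he.extend_apply]
    simp only [he.eq_iff]
  · have hji : j ≠ e i := fun h => hj ⟨i, h.symm⟩
    rw [Function.extend_apply' _ _ _ hj, Function.update_of_ne hji, Function.extend_apply' _ _ _ hj]

theorem extend_eq_self (he : e.Injective) {u s : Regs} (h : ∀ i, s (e i) = u i) :
    Function.extend e u s = s := by
  funext j
  by_cases hj : ∃ l, e l = j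
  · obtain ⟨l, rfl⟩ := hj
    rw [he.extend_apply, h]
  · exact Function.extend_apply' _ _ _ hj

theorem step_rename (O : Oracle) (he : e.Injective) (s : Regs) (γ : Config) :
    step O ⟨γ.todo.map (Prog.rename e), Function.extend e γ.regs s, γ.time⟩ =
      (step O γ).map fun γ =>
        ⟨γ.todo.map (Prog.rename e), Function.extend e γ.regs s, γ.time⟩ := by
  obtain ⟨_ | ⟨c, K⟩, u, t⟩ := γ
  · simp [step, PMF.pure_map]
  cases c with
  | cond i c c₀ c₁ =>
    rcases h : u i with _ | ⟨_ | _, l⟩ <;>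
      simp [Prog.rename, step, PMF.pure_map, he.extend_apply, h]
  | loop i c =>
    rcases h : u i with _ | ⟨b, l⟩ <;> simp [Prog.rename, step, PMF.pure_map, he.extend_apply, h]
  | _ => simp [Prog.rename, step, PMF.map_bind, PMF.pure_map, extend_update he, he.extend_apply]

theorem Exec.rename {O : Oracle} {c : Prog} {u : Regs} {T : ℕ} {μ : PMF Regs}
    (h : Exec O c u T μ) (he : e.Injective) (s : Regs) :
    Exec O (c.rename e) (Function.extend e u s) T (μ.map fun v => Function.extend e v s) :=
  Halts.simulate
    (φ := fun γ => ⟨γ.todo.map (Prog.rename e), Function.extend e γ.regs s, γ.time⟩)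
    (ν := fun v => PMF.pure (Function.extend e v s))
    (fun γ hγ => ⟨by simpa using hγ, step_rename O he s γ⟩) h fun _ _ _ ht => .done ht

end Rename

section Registers

variable {O : Oracle} {s : Regs}

/-- Push `b` on all the registers in `l`. -/
def pushAll (l : List ℕ) (b : Bool) : Prog := l.foldr (fun i c => .seq (.push i b) c) .skip

/-- Empty the register `i`, moving its contents (reversed) to each of the registers in `l`. -/
def moveTo (i : ℕ) (l : List ℕ) : Prog :=
  .loop i (.cond i .skip (.seq (.pop i) (pushAll l false)) (.seq (.pop i) (pushAll l true)))

/-- The registers after moving the contents of register `i` to each of the registers in `l`. -/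
def moved (i : ℕ) (l : List ℕ) (s : Regs) : Regs := fun j =>
  if j = i then [] else if j ∈ l then (s i).reverse ++ s j else s j

/-- Copy the contents of register `j` to register `i`, with register `t` as scratch space. -/
def assign (i j t : ℕ) : Prog :=
  .seq (moveTo t []) (.seq (moveTo j [t]) (.seq (moveTo i []) (moveTo t ([j].insert i))))

/-- Copy the contents of register `σ i` to register `e i`, for each `i < k`, with register `t` as
scratch space. -/
def load (e : ℕ → ℕ) (t : ℕ) : {k : ℕ} → (Fin k → ℕ) → Prog
  | 0, _ => .skip
  | k + 1, σ => .seq (load e t fun i : Fin k => σ i.castSucc) (assign (e k) (σ (Fin.last k)) t)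

/-- Run `c` as a subroutine, on the contents of the registers `σ i` as inputs: its registers are the
registers in the range of `e`. -/
def call (c : Prog) (e : ℕ → ℕ) (t : ℕ) {k : ℕ} (σ : Fin k → ℕ) : Prog :=
  .seq (load e t σ) (c.rename e)

theorem exec_pushAll (O : Oracle) {l : List ℕ} (hl : l.Nodup) (b : Bool) (s : Regs) :
    Exec O (pushAll l b) s (2 * l.length + 1)
      (PMF.pure fun j => if j ∈ l then b :: s j else s j) := by
  induction l generalizing s with
  | nil => simpa [pushAll] using exec_skip O s
  | cons i l ih =>
    obtain ⟨hi, hl⟩ := List.nodup_cons.1 hl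
    have h := (exec_push O s i b).seq_pure (ih hl _)
    refine (Eq.subst (congrArg PMF.pure (funext fun j => ?_)) h).mono
      (by simp only [List.length_cons]; omega)
    rcases eq_or_ne j i with rfl | hj
    · simp [hi]
    · simp [hj]

theorem exec_moveTo (O : Oracle) {l : List ℕ} (hl : l.Nodup) {i : ℕ} (hi : i ∉ l) (s : Regs) :
    Exec O (moveTo i l) s ((s i).length * (2 * l.length + 5) + 1) (PMF.pure (moved i l s)) := by
  have hbody (s' : Regs) (hs' : moved i l s' = moved i l s) (hne : s' i ≠ []) :
      ∃ s₁, moved i l s₁ = moved i l s ∧ s₁ i = (s' i).tail ∧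
        Exec O (.cond i .skip (.seq (.pop i) (pushAll l false)) (.seq (.pop i) (pushAll l true)))
          s' (2 * l.length + 4) (PMF.pure s₁) := by
    obtain ⟨b, u, hu⟩ := List.exists_cons_of_ne_nil hne
    have hpop := (exec_pop O s' i).seq_pure (exec_pushAll O hl b _)
    have hbranch : (bif b then .seq (.pop i) (pushAll l true) else
        .seq (.pop i) (pushAll l false)) = Prog.seq (.pop i) (pushAll l b) := by cases b <;> rfl
    refine ⟨_, ?_, ?_, (Exec.cond_cons hu (hbranch ▸ hpop)).mono (by omega)⟩
    · rw [← hs']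
      funext j
      rcases eq_or_ne j i with rfl | hj
      · simp [moved]
      · by_cases hjl : j ∈ l <;> simp [moved, hj, hjl, hi, hu]
    · simp [hi]
  obtain ⟨s', hs', hnil, h⟩ := exec_loop hbody rfl
  have hmoved : moved i l s' = s' := by
    funext j
    rcases eq_or_ne j i with rfl | hj
    · simp [moved, hnil]
    · simp [moved, hj, hnil]
  rwa [← hs', hmoved]

theorem exec_assign (O : Oracle) {i j t : ℕ} (hi : i ≠ t) (hj : j ≠ t) (s : Regs) :
    Exec O (assign i j t) s (20 * ((s t).length + (s i).length + (s j).length + 1))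
      (PMF.pure (Function.update (Function.update s t []) i (s j))) := by
  have hnodup : ([j].insert i).Nodup := (List.nodup_singleton j).insert
  have hmem : t ∉ [j].insert i := by simp [hi.symm, hj.symm]
  have hlen : ([j].insert i).length ≤ 2 := by
    by_cases h : i = j <;> simp [List.insert, h]
  have h := (exec_moveTo O List.nodup_nil List.not_mem_nil s (i := t)).seq_pure <|
    (exec_moveTo O (List.nodup_singleton t) (by simpa using hj) _).seq_pure <|
    (exec_moveTo O List.nodup_nil List.not_mem_nil _ (i := i)).seq_pure <|
    exec_moveTo O hnodup hmem _
  refine (Eq.subst (congrArg PMF.pure (funext fun r => ?_)) h).mono ?_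
  · rcases eq_or_ne r t with rfl | hrt
    · simp [moved, hi.symm]
    · by_cases hri : r = i <;> by_cases hrj : r = j <;> simp_all [moved]
  · have hback : (s j).length * (2 * ([j].insert i).length + 5) ≤ (s j).length * 9 := by
      gcongr
      omega
    have hclear : (if i = j then [] else s i).length ≤ (s i).length := by split_ifs <;> simp
    simp only [moved, hi, hi.symm, hj, hj.symm, List.mem_singleton, List.not_mem_nil, if_true,
      if_false, List.length_nil, List.length_singleton, List.length_reverse, List.append_nil]
    omega

theorem startRegs_succ {k : ℕ} (a : Fin (k + 1) → Str) :
    startRegs a = Function.update (startRegs fun i : Fin k => a i.castSucc) k (a (Fin.last k)) := by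
  funext i
  rcases lt_trichotomy i k with hi | rfl | hi
  · simp [startRegs, hi, hi.ne, Nat.lt_succ_of_lt hi]
  · simp [startRegs, Fin.last]
  · simp [startRegs, hi.ne', hi.not_gt, show ¬ i < k + 1 by omega]

/-- The registers `s` are ready for a subroutine call: the scratch register `t` and the registers
`e i` of the subroutine are empty, the sources `σ i` of its inputs hold strings of length at most
`n`, and these three groups of registers are disjoint. -/
structure CallReady (s : Regs) (e : ℕ → ℕ) (t : ℕ) {k : ℕ} (σ : Fin k → ℕ) (n : ℕ) : Prop where
  injective : e.Injective
  scratch_eq_nil : s t = []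
  target_eq_nil : ∀ i, s (e i) = []
  target_ne_scratch : ∀ i, e i ≠ t
  source_ne_scratch : ∀ i, σ i ≠ t
  target_ne_source : ∀ j i, e j ≠ σ i
  length_le : ∀ i, (s (σ i)).length ≤ n

theorem CallReady.extend_scratch {e : ℕ → ℕ} {t n k : ℕ} {σ : Fin k → ℕ}
    (hs : CallReady s e t σ n) (u : Regs) : Function.extend e u s t = [] :=
  (Function.extend_apply' _ _ _ fun ⟨i, hi⟩ => hs.target_ne_scratch i hi).trans hs.scratch_eq_nil

theorem exec_load (O : Oracle) {e : ℕ → ℕ} {t n k : ℕ} {σ : Fin k → ℕ}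
    (hs : CallReady s e t σ n) :
    Exec O (load e t σ) s (k * (20 * (n + 1) + 1) + 1)
      (PMF.pure (Function.extend e (startRegs fun i => s (σ i)) s)) := by
  have he := hs.injective
  induction k with
  | zero =>
    rw [extend_eq_self he fun i => by simp [hs.target_eq_nil, startRegs]]
    simpa [load] using exec_skip O s
  | succ k ih =>
    let u := startRegs fun i : Fin k => s (σ i.castSucc)
    have hσ : Function.extend e u s (σ (Fin.last k)) = s (σ (Fin.last k)) :=
      Function.extend_apply' _ _ _ fun ⟨j, hj⟩ => hs.target_ne_source j _ hj
    have ht : Function.extend e u s t = [] := hs.extend_scratch u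
    have hek : Function.extend e u s (e k) = [] := by simp [he.extend_apply, u, startRegs]
    have h := (ih (σ := fun i => σ i.castSucc)
      { hs with
        source_ne_scratch := fun i => hs.source_ne_scratch _
        target_ne_source := fun j i => hs.target_ne_source j _
        length_le := fun i => hs.length_le _ }).seq_pure
      (exec_assign O (hs.target_ne_scratch k) (hs.source_ne_scratch (Fin.last k))
        (Function.extend e u s))
    rw [startRegs_succ, extend_update he]
    rw [hσ, (Function.update_eq_self_iff (a := t)).2 ht.symm, ht, hek] at h
    refine h.mono ?_
    have := hs.length_le (Fin.last k)
    simp only [List.length_nil]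
    linarith

theorem exec_call {c : Prog} {e : ℕ → ℕ} {t n k : ℕ} {σ : Fin k → ℕ} (hs : CallReady s e t σ n)
    {T : ℕ} {μ : PMF Regs} (h : Exec O c (startRegs fun i => s (σ i)) T μ) :
    Exec O (call c e t σ) s (k * (20 * (n + 1) + 1) + T + 2)
      (μ.map fun u => Function.extend e u s) :=
  ((exec_load O hs).seq_pure (h.rename hs.injective s)).mono (by omega)

end Registers

/-! ### Efficient algorithms and their composition -/

section ProgClass

/-- A class of programs that contains the deterministic ones and is closed under composition. -/
class ProgClass (P : Prog → Prop) : Prop where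
  of_deterministic {c : Prog} (h : c.OracleFree) (h' : c.CoinFree) : P c
  seq {c d : Prog} (hc : P c) (hd : P d) : P (.seq c d)
  rename {c : Prog} (e : ℕ → ℕ) (hc : P c) : P (c.rename e)

/-- The programs of deterministic algorithms. -/
def Deterministic (c : Prog) : Prop := c.OracleFree ∧ c.CoinFree

/-- The programs of probabilistic oracle-aided algorithms, that is, all of them. -/
def OracleAided (_ : Prog) : Prop := True

theorem Prog.OracleFree.rename {c : Prog} (e : ℕ → ℕ) (h : c.OracleFree) :
    (c.rename e).OracleFree := by
  induction c with
  | query => exact h.elim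
  | seq c d hc hd => exact ⟨hc h.1, hd h.2⟩
  | cond i c c₀ c₁ hc h₀ h₁ => exact ⟨hc h.1, h₀ h.2.1, h₁ h.2.2⟩
  | loop i c hc => exact hc h
  | _ => trivial

theorem Prog.CoinFree.rename {c : Prog} (e : ℕ → ℕ) (h : c.CoinFree) :
    (c.rename e).CoinFree := by
  induction c with
  | flip => exact h.elim
  | seq c d hc hd => exact ⟨hc h.1, hd h.2⟩
  | cond i c c₀ c₁ hc h₀ h₁ => exact ⟨hc h.1, h₀ h.2.1, h₁ h.2.2⟩
  | loop i c hc => exact hc h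
  | _ => trivial

instance : ProgClass Prog.OracleFree where
  of_deterministic h _ := h
  seq hc hd := ⟨hc, hd⟩
  rename e h := h.rename e

instance : ProgClass Deterministic where
  of_deterministic h h' := ⟨h, h'⟩
  seq hc hd := ⟨⟨hc.1, hd.1⟩, hc.2, hd.2⟩
  rename e h := ⟨h.1.rename e, h.2.rename e⟩

instance : ProgClass OracleAided where
  of_deterministic _ _ := trivial
  seq _ _ := trivial
  rename _ _ := trivial

theorem deterministic_pushAll (l : List ℕ) (b : Bool) : Deterministic (pushAll l b) := by
  induction l with
  | nil => exact ⟨trivial, trivial⟩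
  | cons i l ih => exact ⟨⟨trivial, ih.1⟩, trivial, ih.2⟩

theorem deterministic_moveTo (i : ℕ) (l : List ℕ) : Deterministic (moveTo i l) := by
  have h := deterministic_pushAll l
  simp [Deterministic, moveTo, Prog.OracleFree, Prog.CoinFree, (h _).1, (h _).2]

theorem deterministic_assign (i j t : ℕ) : Deterministic (assign i j t) := by
  have h := deterministic_moveTo
  simp [Deterministic, assign, Prog.OracleFree, Prog.CoinFree, (h _ _).1, (h _ _).2]

theorem deterministic_load (e : ℕ → ℕ) (t : ℕ) {k : ℕ} (σ : Fin k → ℕ) :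
    Deterministic (load e t σ) := by
  induction k with
  | zero => exact ⟨trivial, trivial⟩
  | succ k ih => exact ProgClass.seq (ih _) (deterministic_assign _ _ _)

variable {P : Prog → Prop} [ProgClass P]

theorem Deterministic.progClass {c : Prog} (h : Deterministic c) : P c :=
  ProgClass.of_deterministic h.1 h.2

theorem ProgClass.call {c : Prog} (hc : P c) (e : ℕ → ℕ) (t : ℕ) {k : ℕ} (σ : Fin k → ℕ) :
    P (call c e t σ) :=
  ProgClass.seq (deterministic_load e t σ).progClass (ProgClass.rename e hc)

end ProgClass

/-- `F O a` is the output distribution, on input `a` and with access to `O`, of an algorithm in the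
class `P` with running time and output length polynomial in the input length. (An oracle can give
long answers, so the output length is not bounded by the running time.) -/
def Efficient (P : Prog → Prop) {k : ℕ} (F : Oracle → (Fin k → Str) → PMF Str) : Prop :=
  ∃ (c : Prog) (q : Polynomial ℕ), P c ∧ ∀ (O : Oracle) (a : Fin k → Str),
    c.OutputsWithin outStr O a (q.eval (inputLength a)) (F O a) ∧
      ∀ y ∈ (F O a).support, y.length ≤ q.eval (inputLength a)

/-- `f` is computable in deterministic polynomial time. -/
def EfficientFun {k : ℕ} (f : (Fin k → Str) → Str) : Prop :=
  Efficient Deterministic fun _ a => PMF.pure (f a)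

section Efficient

variable {P : Prog → Prop} {k : ℕ}

theorem Efficient.mono {P' : Prog → Prop} (hP : ∀ c, P c → P' c)
    {F : Oracle → (Fin k → Str) → PMF Str} (h : Efficient P F) : Efficient P' F := by
  obtain ⟨c, q, hc, h⟩ := h
  exact ⟨c, q, hP c hc, h⟩

theorem Efficient.congr {F F' : Oracle → (Fin k → Str) → PMF Str} (h : Efficient P F)
    (hF : ∀ O a, F O a = F' O a) : Efficient P F' := by
  rwa [← funext₂ hF]

theorem EfficientFun.efficient [ProgClass P] {f : (Fin k → Str) → Str} (h : EfficientFun f) :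
    Efficient P fun _ a => PMF.pure (f a) :=
  h.mono fun _ hc => hc.progClass

theorem eval_mono (q : Polynomial ℕ) : Monotone fun n => q.eval n := by
  intro m n h
  simp only [Polynomial.eval_eq_sum]
  exact Finset.sum_le_sum fun i _ => Nat.mul_le_mul_left _ (Nat.pow_le_pow_left h i)

theorem length_le_inputLength (a : Fin k → Str) (i : Fin k) : (a i).length ≤ inputLength a :=
  Finset.single_le_sum (f := fun i => (a i).length) (fun _ _ => Nat.zero_le _) (Finset.mem_univ i)

theorem length_startRegs_le {a : Fin k → Str} {n : ℕ} (ha : ∀ i, (a i).length ≤ n) (i : ℕ) :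
    (startRegs a i).length ≤ n := by
  unfold startRegs
  split_ifs
  · exact ha _
  · simp

theorem EfficientFun.of_exec {f : (Fin k → Str) → Str} {c : Prog} (hc : Deterministic c)
    (q : Polynomial ℕ) (h : ∀ O a, ∃ s,
      Exec O c (startRegs a) (q.eval (inputLength a)) (PMF.pure s) ∧ s 0 = f a) :
    EfficientFun f := by
  refine ⟨c, q + Polynomial.X, hc, fun O a => ?_⟩
  obtain ⟨s, hs, hf⟩ := h O a
  simp only [Polynomial.eval_add, Polynomial.eval_X, ← hf]
  refine ⟨outputsWithin_iff.2 ⟨_, hs.mono (Nat.le_add_right _ _), PMF.pure_map _ _⟩,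
    fun y hy => ?_⟩
  obtain rfl := (PMF.mem_support_pure_iff _ _).1 hy
  have := hs.length_le (s₁ := s) hc.1 (by simp) 0
  have := length_startRegs_le (length_le_inputLength a) 0
  omega

theorem Efficient.of_register [ProgClass P] {β : Type} {out : Regs → β} {g : β → Str} {j : ℕ}
    (hg : ∀ s, g (out s) = s j) {F : Oracle → (Fin k → Str) → PMF β} {c : Prog} (hP : P c)
    (hc : c.OracleFree) (q : Polynomial ℕ)
    (h : ∀ O a, c.OutputsWithin out O a (q.eval (inputLength a)) (F O a)) :
    Efficient P fun O a => (F O a).map g := by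
  refine ⟨.seq c (assign 0 j (j + 1)), q + 60 * (q + Polynomial.X) + 21,
    ProgClass.seq hP (deterministic_assign _ _ _).progClass, fun O a => ?_⟩
  obtain ⟨μ, hμ, hF⟩ := outputsWithin_iff.1 (h O a)
  have hlen : ∀ s ∈ μ.support, ∀ i, (s i).length ≤ inputLength a + q.eval (inputLength a) :=
    fun s hs i => (hμ.length_le hc hs i).trans
      (Nat.add_le_add_right (length_startRegs_le (length_le_inputLength a) i) _)
  simp only [Polynomial.eval_add, Polynomial.eval_mul, Polynomial.eval_X, Polynomial.eval_ofNat]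
  constructor
  · obtain ⟨ξ, hξ, hout⟩ := hμ.exists_seq (f := outStr) (F := fun s => PMF.pure (g (out s)))
      (d := assign 0 j (j + 1)) (T' := 60 * (q.eval (inputLength a) + inputLength a) + 20)
      fun s hs => ⟨_, (exec_assign O (by simp) (by simp) s).mono (by
        have := hlen s hs (j + 1)
        have := hlen s hs 0
        have := hlen s hs j
        omega), by simp [PMF.pure_map, outStr, hg]⟩
    refine outputsWithin_iff.2 ⟨ξ, hξ.mono (by omega), ?_⟩
    rw [hout, ← hF, PMF.map_comp]
    rfl
  · rintro _ hy
    simp only [← hF, PMF.mem_support_map_iff] at hy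
    obtain ⟨_, ⟨s, hs, rfl⟩, rfl⟩ := hy
    rw [hg]
    have := hlen s hs j
    omega

end Efficient

section Composition

variable {P : Prog → Prop} [ProgClass P] {k m : ℕ}

theorem inputLength_comp_le (a : Fin m → Str) (σ : Fin k → Fin m) :
    inputLength (fun i => a (σ i)) ≤ k * inputLength a :=
  (Finset.sum_le_card_nsmul Finset.univ _ _ fun i _ => length_le_inputLength a (σ i)).trans
    (by simp)

theorem inputLength_cons (y : Str) (a : Fin m → Str) :
    inputLength (Fin.cons y a : Fin (m + 1) → Str) = y.length + inputLength a := by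
  simp [inputLength, Fin.sum_univ_succ]

/-- Run `d` as a subroutine, and copy its output to register `0`. -/
def callOutput (d : Prog) (e : ℕ → ℕ) (t : ℕ) (σ : Fin k → ℕ) : Prog :=
  .seq (call d e t σ) (assign 0 (e 0) t)

theorem exec_callOutput {O : Oracle} {d : Prog} {s : Regs} {e : ℕ → ℕ} {t n : ℕ} {σ : Fin k → ℕ}
    (hs : CallReady s e t σ n) (ht : t ≠ 0) (he : ∀ i, e i ≠ 0) {T : ℕ} {ν : PMF Regs}
    (hd : Exec O d (startRegs fun i => s (σ i)) T ν) {n' : ℕ}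
    (hν : ∀ u ∈ ν.support, (u 0).length ≤ n') :
    ∃ ξ, Exec O (callOutput d e t σ) s
        (k * (20 * (n + 1) + 1) + T + 20 * ((s 0).length + n' + 1) + 3) ξ ∧
      ξ.map outStr = ν.map outStr := by
  obtain ⟨ξ, hξ, hout⟩ := (exec_call hs hd).exists_seq (f := outStr)
    (F := fun s' => PMF.pure (s' (e 0))) (d := assign 0 (e 0) t)
    (T' := 20 * ((s 0).length + n' + 1)) fun s' hs' => by
      obtain ⟨u, hu, rfl⟩ := (PMF.mem_support_map_iff _ _ _).1 hs'
      refine ⟨_, (exec_assign O ht.symm (hs.target_ne_scratch 0) _).mono ?_,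
        by simp [PMF.pure_map, outStr]⟩
      rw [hs.extend_scratch, Function.extend_apply' _ _ _ fun ⟨i, hi⟩ => he i hi,
        hs.injective.extend_apply]
      have := hν u hu
      simp only [List.length_nil]
      omega
  refine ⟨ξ, hξ.mono (by omega), ?_⟩
  rw [hout, PMF.bind_map]
  simp only [Function.comp_def, hs.injective.extend_apply]
  rfl

/-- Run `c` on the inputs `σ i`, and then `d` on the output of `c` and all the inputs. Both programs
get registers of their own, above the `m` inputs and the scratch register `m + 1`. -/
def bindProg (c d : Prog) (σ : Fin k → Fin m) : Prog :=
  .seq (call c (fun i => m + 2 + 2 * i) (m + 1) fun i => (σ i : ℕ))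
    (callOutput d (fun i => m + 3 + 2 * i) (m + 1)
      (Fin.cons (m + 2) fun i : Fin m => (i : ℕ) : Fin (m + 1) → ℕ))

theorem startRegs_val (a : Fin m → Str) (i : Fin m) : startRegs a i = a i := by
  simp [startRegs]

theorem startRegs_of_le (a : Fin m → Str) {i : ℕ} (hi : m ≤ i) : startRegs a i = [] := by
  simp [startRegs, hi.not_gt]

theorem callReady_bindProg_left {a : Fin m → Str} {n : ℕ} (ha : ∀ i, (a i).length ≤ n)
    (σ : Fin k → Fin m) :
    CallReady (startRegs a) (fun i => m + 2 + 2 * i) (m + 1) (fun i => (σ i : ℕ)) n where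
  injective i j h := by simpa using h
  scratch_eq_nil := startRegs_of_le a (by omega)
  target_eq_nil i := startRegs_of_le a (by omega)
  target_ne_scratch i := by omega
  source_ne_scratch i := by omega
  target_ne_source j i := by omega
  length_le i := by simpa only [startRegs_val] using ha (σ i)

theorem extend_bindProg_inputs (a : Fin m → Str) (u : Regs) :
    (fun i => Function.extend (fun i => m + 2 + 2 * i) u (startRegs a)
      ((Fin.cons (m + 2) fun i : Fin m => (i : ℕ) : Fin (m + 1) → ℕ) i)) = Fin.cons (u 0) a := by
  have he : Function.Injective fun i => m + 2 + 2 * i := fun i j h => by simpa using h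
  funext i
  induction i using Fin.cases with
  | zero => exact he.extend_apply u _ 0
  | succ i =>
    rw [Fin.cons_succ, Fin.cons_succ, Function.extend_apply' _ _ _ fun ⟨_, _⟩ => by omega,
      startRegs_val]

theorem callReady_bindProg_right {a : Fin m → Str} {n : ℕ} (ha : ∀ i, (a i).length ≤ n)
    {u : Regs} (hu : (u 0).length ≤ n) :
    CallReady (Function.extend (fun i => m + 2 + 2 * i) u (startRegs a)) (fun i => m + 3 + 2 * i)
      (m + 1) (Fin.cons (m + 2) fun i : Fin m => (i : ℕ) : Fin (m + 1) → ℕ) n where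
  injective i j h := by simpa using h
  scratch_eq_nil := by
    rw [Function.extend_apply' _ _ _ fun ⟨_, _⟩ => by omega, startRegs_of_le a (by omega)]
  target_eq_nil i := by
    rw [Function.extend_apply' _ _ _ fun ⟨_, _⟩ => by omega, startRegs_of_le a (by omega)]
  target_ne_scratch i := by omega
  source_ne_scratch i := by
    induction i using Fin.cases <;> simp only [Fin.cons_zero, Fin.cons_succ] <;> omega
  target_ne_source j i := by
    induction i using Fin.cases <;> simp only [Fin.cons_zero, Fin.cons_succ] <;> omega
  length_le i := by
    rw [congrFun (extend_bindProg_inputs a u) i]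
    induction i using Fin.cases
    · exact hu
    · exact ha _

theorem exec_bindProg {O : Oracle} {c d : Prog} {σ : Fin k → Fin m} {a : Fin m → Str}
    {n n' T T' : ℕ} {μ : PMF Regs} {G : Str → PMF Str} (ha : ∀ i, (a i).length ≤ n)
    (hc : Exec O c (startRegs fun i => a (σ i)) T μ) (hμ : ∀ u ∈ μ.support, (u 0).length ≤ n)
    (hd : ∀ y : Str, y.length ≤ n →
      d.OutputsWithin outStr O (Fin.cons y a : Fin (m + 1) → Str) T' (G y) ∧
        ∀ z ∈ (G y).support, z.length ≤ n') :
    ∃ ξ, Exec O (bindProg c d σ) (startRegs a)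
        (k * (20 * (n + 1) + 1) + T + (m + 1) * (20 * (n + 1) + 1) + T' +
          20 * (n + n' + 1) + 6) ξ ∧
      ξ.map outStr = (μ.map outStr).bind G := by
  have hleft := callReady_bindProg_left ha σ
  obtain ⟨ξ, hξ, hout⟩ := (exec_call (c := c) hleft
    (by simpa only [startRegs_val] using hc)).exists_seq (f := outStr)
    (F := fun s => G (s (m + 2)))
    (T' := (m + 1) * (20 * (n + 1) + 1) + T' + 20 * (n + n' + 1) + 3)
    (d := callOutput d (fun i => m + 3 + 2 * i) (m + 1)
      (Fin.cons (m + 2) fun i : Fin m => (i : ℕ) : Fin (m + 1) → ℕ)) fun s hs => by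
    obtain ⟨u, hu, rfl⟩ := (PMF.mem_support_map_iff _ _ _).1 hs
    obtain ⟨hdu, hlen⟩ := hd (u 0) (hμ u hu)
    obtain ⟨ν, hν, hνG⟩ := outputsWithin_iff.1 hdu
    rw [← extend_bindProg_inputs] at hν
    obtain ⟨ξ, hξ, hout⟩ := exec_callOutput (callReady_bindProg_right ha (hμ u hu)) (by omega)
      (fun i => by omega) hν (n' := n') fun v hv =>
        hlen _ (hνG ▸ (PMF.mem_support_map_iff _ _ _).2 ⟨v, hv, rfl⟩)
    refine ⟨ξ, hξ.mono ?_, ?_⟩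
    · have hzero : (Function.extend (fun i => m + 2 + 2 * i) u (startRegs a) 0).length ≤ n := by
        rw [Function.extend_apply' _ _ _ fun ⟨_, _⟩ => by omega]
        exact length_startRegs_le ha 0
      omega
    · rw [hout, hνG, show m + 2 = m + 2 + 2 * 0 by omega, hleft.injective.extend_apply u _ 0]
  refine ⟨ξ, hξ.mono (by omega), ?_⟩
  rw [hout, PMF.bind_map, PMF.bind_map]
  congr 1
  funext u
  exact congrArg G (hleft.injective.extend_apply u _ 0)

theorem Efficient.bind {F : Oracle → (Fin k → Str) → PMF Str}
    {G : Oracle → (Fin (m + 1) → Str) → PMF Str} (hF : Efficient P F) (hG : Efficient P G)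
    (σ : Fin k → Fin m) :
    Efficient P fun O a => (F O fun i => a (σ i)).bind fun y => G O (Fin.cons y a) := by
  obtain ⟨c, p, hc, hF⟩ := hF
  obtain ⟨d, q, hd, hG⟩ := hG
  let n : Polynomial ℕ := Polynomial.X + p.comp ((k : Polynomial ℕ) * Polynomial.X)
  let q' := q.comp (n + Polynomial.X)
  refine ⟨bindProg c d σ, (k : Polynomial ℕ) * (20 * (n + 1) + 1) + n +
    ((m : Polynomial ℕ) + 1) * (20 * (n + 1) + 1) + q' + 20 * (n + q' + 1) + 6,
    ProgClass.seq (ProgClass.call hc _ _ _)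
      (ProgClass.seq (ProgClass.call hd _ _ _) (deterministic_assign _ _ _).progClass),
    fun O a => ?_⟩
  obtain ⟨hFa, hFlen⟩ := hF O fun i => a (σ i)
  obtain ⟨μ, hμ, hμF⟩ := outputsWithin_iff.1 hFa
  have hp : p.eval (inputLength fun i => a (σ i)) ≤ n.eval (inputLength a) := by
    simpa [n] using (eval_mono p (inputLength_comp_le a σ)).trans (Nat.le_add_left _ _)
  have hq {y : Str} (hy : y.length ≤ n.eval (inputLength a)) :
      q.eval (inputLength (Fin.cons y a : Fin (m + 1) → Str)) ≤ q'.eval (inputLength a) := by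
    rw [inputLength_cons]
    simpa [q'] using eval_mono q (Nat.add_le_add_right hy _)
  have hn (i : Fin m) : (a i).length ≤ n.eval (inputLength a) :=
    (length_le_inputLength a i).trans (by simp [n])
  obtain ⟨ξ, hξ, hout⟩ := exec_bindProg (G := fun y => G O (Fin.cons y a)) hn (hμ.mono hp)
    (fun u hu => (hFlen _ (hμF ▸ (PMF.mem_support_map_iff _ _ _).2 ⟨u, hu, rfl⟩)).trans hp)
    fun y hy => ⟨(hG O (Fin.cons y a)).1.mono (hq hy), fun z hz => ((hG O _).2 z hz).trans (hq hy)⟩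
  rw [hμF] at hout
  refine ⟨outputsWithin_iff.2 ⟨ξ, hξ.mono ?_, hout⟩, fun z hz => ?_⟩
  · simp
  · obtain ⟨y, hy, hz⟩ := (PMF.mem_support_bind_iff _ _ _).1 hz
    refine (((hG O _).2 z hz).trans (hq ((hFlen y hy).trans hp))).trans ?_
    simp only [Polynomial.eval_add]
    omega

theorem efficientFun_proj (i : Fin m) : EfficientFun fun a => a i := by
  refine .of_exec (deterministic_assign 0 i (i + 1)) (60 * Polynomial.X + 20) fun O a => ?_
  have ha (j : ℕ) := length_startRegs_le (length_le_inputLength a) j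
  refine ⟨_, (exec_assign O (by omega) (by omega) _).mono ?_, by simp [startRegs_val]⟩
  have := ha 0
  have := ha i
  have := ha (i + 1)
  simp only [Polynomial.eval_add, Polynomial.eval_mul, Polynomial.eval_X, Polynomial.eval_ofNat]
  omega

theorem Efficient.reindex {F : Oracle → (Fin k → Str) → PMF Str} (hF : Efficient P F)
    (σ : Fin k → Fin m) : Efficient P fun O a => F O fun i => a (σ i) := by
  simpa using hF.bind (efficientFun_proj 0).efficient σ

/-- The form of `Efficient.comp` in which each argument is either one of the values `f j` or one of
the inputs. The `f j` can then be computed one after another, extending the list of inputs. -/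
theorem Efficient.comp_sum {l : ℕ} {G : Oracle → (Fin l → Str) → PMF Str} (hG : Efficient P G)
    {f : Fin k → (Fin m → Str) → Str} (hf : ∀ j, EfficientFun (f j)) (σ : Fin l → Fin k ⊕ Fin m) :
    Efficient P fun O a => G O fun i => Sum.elim (fun j => f j a) a (σ i) := by
  induction k generalizing m with
  | zero =>
    refine (hG.reindex fun i => (σ i).elim Fin.elim0 id).congr fun O a => congrArg _ (funext ?_)
    intro i
    rcases σ i with j | j
    · exact j.elim0
    · rfl
  | succ k ih =>
    let τ : Fin (k + 1) ⊕ Fin m → Fin k ⊕ Fin (m + 1) :=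
      Sum.elim (Fin.cases (.inr 0) .inl) fun j => .inr j.succ
    have h := ih (m := m + 1) (f := fun j b => f j.succ fun i => b i.succ)
      (fun j => (hf j.succ).reindex Fin.succ) fun i => τ (σ i)
    refine ((hf 0).efficient.bind h id).congr fun O a => ?_
    simp only [PMF.pure_bind, id]
    refine congrArg _ (funext fun i => ?_)
    rcases σ i with j | j
    · induction j using Fin.cases <;> rfl
    · rfl

theorem Efficient.comp {G : Oracle → (Fin k → Str) → PMF Str} (hG : Efficient P G)
    {f : Fin k → (Fin m → Str) → Str} (hf : ∀ j, EfficientFun (f j)) :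
    Efficient P fun O a => G O fun j => f j a :=
  hG.comp_sum hf .inl

variable {f g h : (Fin m → Str) → Str}

theorem Efficient.comp₁ {G : Oracle → (Fin 1 → Str) → PMF Str} (hG : Efficient P G)
    (hf : EfficientFun f) : Efficient P fun O a => G O ![f a] :=
  (hG.comp (f := ![f]) (by simpa using hf)).congr fun O a =>
    congrArg _ (funext fun i => by fin_cases i; rfl)

theorem Efficient.comp₂ {G : Oracle → (Fin 2 → Str) → PMF Str} (hG : Efficient P G)
    (hf : EfficientFun f) (hg : EfficientFun g) : Efficient P fun O a => G O ![f a, g a] :=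
  (hG.comp (f := ![f, g]) (by simpa [Fin.forall_fin_succ] using ⟨hf, hg⟩)).congr fun O a =>
    congrArg _ (funext fun i => by fin_cases i <;> rfl)

theorem Efficient.comp₃ {G : Oracle → (Fin 3 → Str) → PMF Str} (hG : Efficient P G)
    (hf : EfficientFun f) (hg : EfficientFun g) (hh : EfficientFun h) :
    Efficient P fun O a => G O ![f a, g a, h a] :=
  (hG.comp (f := ![f, g, h]) (by simpa [Fin.forall_fin_succ] using ⟨hf, hg, hh⟩)).congr fun O a =>
    congrArg _ (funext fun i => by fin_cases i <;> rfl)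

end Composition

/-! ### Basic efficient algorithms -/

section Basic

variable {m : ℕ}

theorem efficientFun_singleton_true : EfficientFun fun _ : Fin m → Str => [true] := by
  have h : EfficientFun fun _ : Fin 0 → Str => [true] :=
    .of_exec (c := .push 0 true) ⟨trivial, trivial⟩ 1 fun O a =>
      ⟨_, (exec_push O _ 0 true).mono (by simp), by simp [startRegs]⟩
  exact h.reindex Fin.elim0

theorem efficientFun_headD_cons :
    EfficientFun fun a : Fin 2 → Str => (a 0).headD false :: a 1 := by
  have hdet := deterministic_assign
  refine .of_exec (c := .seq (.cond 0 (.push 1 false) (.push 1 false) (.push 1 true))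
    (assign 0 1 2)) (by simp [Deterministic, Prog.OracleFree, Prog.CoinFree, (hdet _ _ _).1,
      (hdet _ _ _).2]) (40 * Polynomial.X + 43) fun O a => ?_
  have h₀ : startRegs a 0 = a 0 := rfl
  have h₂ : startRegs a 2 = [] := rfl
  have hpush : Exec O (.cond 0 (.push 1 false) (.push 1 false) (.push 1 true)) (startRegs a) 2
      (PMF.pure (Function.update (startRegs a) 1 ((a 0).headD false :: a 1))) := by
    rcases h : a 0 with _ | ⟨b, u⟩
    · exact Exec.cond_nil h (exec_push O _ 1 false)
    · refine Exec.cond_cons (h₀.trans h) ?_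
      cases b <;> exact exec_push O _ 1 _
  refine ⟨_, (hpush.seq_pure (exec_assign O (by simp) (by simp) _)).mono ?_, by simp⟩
  have := length_le_inputLength a 0
  have := length_le_inputLength a 1
  simp only [ne_eq, OfNat.ofNat_ne_one, zero_ne_one, not_false_eq_true, Function.update_of_ne,
    Function.update_self, h₀, h₂, List.length_nil, List.length_cons, Polynomial.eval_add,
    Polynomial.eval_mul, Polynomial.eval_ofNat, Polynomial.eval_X]
  omega

theorem efficientFun_unary_length : EfficientFun fun a : Fin 1 → Str => unary (a 0).length := by
  have hdet := deterministic_moveTo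
  refine .of_exec (c := .seq (.loop 0 (.seq (.pop 0) (.push 1 true))) (moveTo 1 [0]))
    (by simp [Deterministic, Prog.OracleFree, Prog.CoinFree, (hdet _ _).1, (hdet _ _).2])
    (11 * Polynomial.X + 3) fun O a => ?_
  have h₀ : startRegs a 0 = a 0 := rfl
  obtain ⟨s, hs, hnil, h⟩ := exec_loop (O := O) (s := startRegs a) (i := 0)
    (I := fun s => unary (s 0).length ++ s 1 = unary (a 0).length)
    (fun s hs hne => ⟨_, by
      obtain ⟨b, u, hu⟩ := List.exists_cons_of_ne_nil hne
      rw [← hs]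
      simp [hu, unary, List.replicate_succ'], by simp,
      (exec_pop O s 0).seq_pure (exec_push O _ 1 true)⟩)
    (by simp [startRegs])
  have hs₁ : s 1 = unary (a 0).length := by simpa [hnil, unary] using hs
  refine ⟨_, (h.seq_pure (exec_moveTo O (l := [0]) (by simp) (by simp) s)).mono ?_,
    by simp [moved, hnil, hs₁, unary]⟩
  have := length_le_inputLength a 0
  simp only [h₀, hs₁, unary, List.length_replicate, List.length_singleton, Polynomial.eval_add,
    Polynomial.eval_mul, Polynomial.eval_ofNat, Polynomial.eval_X]
  omega

/-- Compare the next bit `b` of register `0` with register `1`, removing it from both, or record a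
mismatch in register `2`. -/
def eqBit (b : Bool) : Prog :=
  .seq (.pop 0) (.cond 1 (.push 2 true) (bif b then .push 2 true else .pop 1)
    (bif b then .pop 1 else .push 2 true))

/-- Do registers `0` and `1` hold the same string? -/
def eqInputs : Prog :=
  .seq (.loop 0 (.cond 0 .skip (eqBit false) (eqBit true)))
    (.cond 2 (.cond 1 (.push 0 true) (.push 0 false) (.push 0 false)) (.push 0 false)
      (.push 0 false))

theorem exec_eqBit (O : Oracle) {b : Bool} {u : Str} {s : Regs} (hs : s 0 = b :: u) :
    ∃ s₁, Exec O (eqBit b) s 4 (PMF.pure s₁) ∧ s₁ 0 = u ∧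
      (s₁ 2 = [] ∧ s₁ 0 = s₁ 1 ↔ s 2 = [] ∧ s 0 = s 1) := by
  have hpop := exec_pop O s 0
  have hs₁ : Function.update s 0 (s 0).tail 1 = s 1 := by simp
  rcases h : s 1 with _ | ⟨b', v⟩
  · exact ⟨_, hpop.seq_pure (.cond_nil (hs₁.trans h) (exec_push O _ 2 true)), by simp [hs],
      by simp [hs]⟩
  by_cases hb : b = b'
  · subst hb
    refine ⟨Function.update (Function.update s 0 u) 1 v,
      hpop.seq_pure (.cond_cons (T := 1) (hs₁.trans h) ?_), by simp, by simp [hs]⟩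
    have := exec_pop O (Function.update s 0 u) 1
    cases b <;> simpa [hs, h] using this
  · refine ⟨Function.update (Function.update s 0 u) 2 (true :: s 2),
      hpop.seq_pure (.cond_cons (T := 1) (hs₁.trans h) ?_), by simp, by simp [hs, h, hb]⟩
    have := exec_push O (Function.update s 0 u) 2 true
    cases b <;> cases b' <;> simp_all

theorem exec_eqInputs (O : Oracle) {s : Regs} (hs : s 2 = []) :
    ∃ s', Exec O eqInputs s (6 * (s 0).length + 5) (PMF.pure s') ∧ s' 0 = [decide (s 0 = s 1)] := by
  obtain ⟨s', hI, hnil, h⟩ := exec_loop (O := O) (s := s) (i := 0) (T := 5)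
    (I := fun s' => s' 2 = [] ∧ s' 0 = s' 1 ↔ s 0 = s 1)
    (c := .cond 0 .skip (eqBit false) (eqBit true)) (fun s' hI hne => by
      obtain ⟨b, u, hu⟩ := List.exists_cons_of_ne_nil hne
      obtain ⟨s₁, h, htail, hiff⟩ := exec_eqBit O hu
      refine ⟨s₁, hiff.trans hI, by rw [htail, hu, List.tail_cons], .cond_cons hu ?_⟩
      cases b <;> exact h) (by simp [hs])
  have hdecide : ∃ s₁, Exec O (.cond 2 (.cond 1 (.push 0 true) (.push 0 false) (.push 0 false))
      (.push 0 false) (.push 0 false)) s' 3 (PMF.pure s₁) ∧ s₁ 0 = [decide (s 0 = s 1)] := by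
    rcases h₂ : s' 2 with _ | ⟨b, u⟩
    · rcases h₁ : s' 1 with _ | ⟨b, u⟩
      · exact ⟨_, .cond_nil h₂ (.cond_nil h₁ (exec_push O s' 0 true)),
          by simp [hnil, ← hI, h₁, h₂]⟩
      · exact ⟨_, .cond_nil h₂ (.cond_cons h₁ (by cases b <;> exact exec_push O s' 0 false)),
          by simp [hnil, ← hI, h₁]⟩
    · exact ⟨_, (Exec.cond_cons h₂ (by cases b <;> exact exec_push O s' 0 false)).mono (by simp),
        by simp [hnil, ← hI, h₂]⟩
  obtain ⟨s₁, h₁, hs₁⟩ := hdecide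
  exact ⟨s₁, (h.seq_pure h₁).mono (by omega), hs₁⟩

theorem efficientFun_decide_eq : EfficientFun fun a : Fin 2 → Str => [decide (a 0 = a 1)] := by
  refine .of_exec (c := eqInputs) (by simp [Deterministic, eqInputs, eqBit, Prog.OracleFree,
    Prog.CoinFree]) (6 * Polynomial.X + 5) fun O a => ?_
  obtain ⟨s, h, hs⟩ := exec_eqInputs O (s := startRegs a) rfl
  have h₀ : startRegs a 0 = a 0 := rfl
  have := length_le_inputLength a 0
  refine ⟨s, h.mono ?_, hs⟩
  simp only [h₀, Polynomial.eval_add, Polynomial.eval_mul, Polynomial.eval_ofNat, Polynomial.eval_X]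
  omega

/-- Move bits from register `3` to register `4`, one for each bit of register `0`. -/
def truncate : Prog :=
  .loop 0 (.seq (.pop 0) (.cond 3 .skip (.seq (.pop 3) (.push 4 false))
    (.seq (.pop 3) (.push 4 true))))

theorem exec_truncate (O : Oracle) {s : Regs} (hs : s 4 = []) :
    ∃ s', Exec O truncate s (7 * (s 0).length + 1) (PMF.pure s') ∧ s' 0 = [] ∧
      s' 4 = ((s 3).take (s 0).length).reverse := by
  obtain ⟨s', hI, hnil, h⟩ := exec_loop (O := O) (s := s) (i := 0) (T := 6)
    (I := fun s' => (s' 4).reverse ++ (s' 3).take (s' 0).length = (s 3).take (s 0).length)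
    (c := .seq (.pop 0) (.cond 3 .skip (.seq (.pop 3) (.push 4 false))
      (.seq (.pop 3) (.push 4 true)))) (fun s' hI hne => by
      obtain ⟨_, u, hu⟩ := List.exists_cons_of_ne_nil hne
      have hpop := exec_pop O s' 0
      rw [← hI]
      rcases h₃ : s' 3 with _ | ⟨b, v⟩
      · exact ⟨_, by simp [h₃], by simp, (hpop.seq_pure (.cond_nil (by simpa using h₃)
          (exec_skip O _))).mono (by simp)⟩
      · have hbranch : (bif b then .seq (.pop 3) (.push 4 true) else
            .seq (.pop 3) (.push 4 false)) = Prog.seq (.pop 3) (.push 4 b) := by cases b <;> rfl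
        exact ⟨_, by simp [h₃, hu], by simp, hpop.seq_pure (.cond_cons (by simpa using h₃)
          (hbranch ▸ (exec_pop O _ 3).seq_pure (exec_push O _ 4 b)))⟩) (by simp [hs])
  refine ⟨s', h.mono (by omega), hnil, ?_⟩
  rw [← hI]
  simp [hnil]

/-- Only a prefix of the answer is kept, since oracle answers can be arbitrarily long. -/
theorem efficient_query_take : Efficient OracleAided fun O (a : Fin 3 → Str) =>
    (O (a 1) (a 2)).map (List.take (a 0).length) := by
  refine ⟨.seq (.query 1 2 3) (.seq truncate (moveTo 4 [0])), 20 * Polynomial.X + 10, trivial,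
    fun O a => ⟨?_, ?_⟩⟩
  · have hr₀ : startRegs a 0 = a 0 := rfl
    have hr₁ : startRegs a 1 = a 1 := rfl
    have hr₂ : startRegs a 2 = a 2 := rfl
    obtain ⟨ξ, hξ, hout⟩ := (exec_query O (startRegs a) 1 2 3).exists_seq (f := outStr)
      (F := fun s => PMF.pure ((s 3).take (a 0).length)) (T' := 14 * (a 0).length + 3)
      (d := .seq truncate (moveTo 4 [0])) fun s hs => by
        obtain ⟨y, -, rfl⟩ := (PMF.mem_support_map_iff _ _ _).1 hs
        obtain ⟨s', h, h₀, h₄⟩ := exec_truncate O (s := Function.update (startRegs a) 3 y) rfl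
        have hlen : (s' 4).length ≤ (a 0).length := by
          rw [h₄, List.length_reverse]
          exact List.length_take_le _ _
        refine ⟨_, (h.seq_pure (exec_moveTo O (l := [0]) (by simp) (by simp) s')).mono ?_, ?_⟩
        · simp only [Function.update_of_ne, ne_eq, OfNat.zero_ne_ofNat, not_false_eq_true,
            List.length_singleton, hr₀]
          omega
        · simp [PMF.pure_map, outStr, moved, h₀, h₄, hr₀]
    refine outputsWithin_iff.2 ⟨ξ, hξ.mono ?_, ?_⟩
    · simp only [Polynomial.eval_add, Polynomial.eval_mul, Polynomial.eval_X, Polynomial.eval_ofNat,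
        inputLength, Fin.sum_univ_three, hr₁, hr₂]
      omega
    · simp [hout, ← PMF.bind_pure_comp, Function.comp_def, hr₁, hr₂]
  · rintro y hy
    obtain ⟨z, -, rfl⟩ := (PMF.mem_support_map_iff _ _ _).1 hy
    have := length_le_inputLength a 0
    have := List.length_take_le (a 0).length z
    simp only [Polynomial.eval_add, Polynomial.eval_mul, Polynomial.eval_X, Polynomial.eval_ofNat]
    omega

end Basic

section Conversions

variable {P : Prog → Prop} {k : ℕ}

theorem Efficient.of_isPPT {F : (Fin k → Str) → PMF Str} (h : IsPPT outStr F) :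
    Efficient Prog.OracleFree fun _ => F := by
  obtain ⟨c, q, hc, h⟩ := h
  simpa only [PMF.map_id] using
    Efficient.of_register (P := Prog.OracleFree) (g := id) (fun _ => rfl) hc hc q h

theorem Efficient.isPPT {F : (Fin k → Str) → PMF Str}
    (h : Efficient Prog.OracleFree fun _ => F) : IsPPT outStr F := by
  obtain ⟨c, q, hc, h⟩ := h
  exact ⟨c, q, hc, fun O a => (h O a).1⟩

theorem EfficientFun.isPolyTime {f : (Fin k → Str) → Str} (h : EfficientFun f) :
    IsPolyTime outStr f := by
  obtain ⟨c, q, hc, h⟩ := h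
  exact ⟨c, q, hc.1, hc.2, fun O a => (h O a).1⟩

theorem EfficientFun.of_register {β : Type} {out : Regs → β} {g : β → Str} {j : ℕ}
    (hg : ∀ s, g (out s) = s j) {f : (Fin k → Str) → β} (h : IsPolyTime out f) :
    EfficientFun fun a => g (f a) := by
  obtain ⟨c, q, hc, hc', h⟩ := h
  exact (Efficient.of_register hg ⟨hc, hc'⟩ hc q h).congr fun _ _ => PMF.pure_map _ _

theorem EfficientFun.of_isPolyTime {f : (Fin k → Str) → Str} (h : IsPolyTime outStr f) :
    EfficientFun f :=
  .of_register (g := id) (fun _ => rfl) h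

theorem EfficientFun.fst_of_isPolyTime {f : (Fin k → Str) → Str × Str}
    (h : IsPolyTime outPair f) : EfficientFun fun a => (f a).1 :=
  .of_register (fun _ => rfl) h

theorem EfficientFun.snd_of_isPolyTime {f : (Fin k → Str) → Str × Str}
    (h : IsPolyTime outPair f) : EfficientFun fun a => (f a).2 :=
  .of_register (fun _ => rfl) h

theorem Efficient.of_outBit [ProgClass P] {F : Oracle → (Fin k → Str) → PMF Bool} {c : Prog}
    (hP : P c) (hc : c.OracleFree) (q : Polynomial ℕ)
    (h : ∀ O a, c.OutputsWithin outBit O a (q.eval (inputLength a)) (F O a)) :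
    Efficient P fun O a => (F O a).map fun b => [b] := by
  have hstr := Efficient.of_register (out := outStr) (g := id) (fun _ => rfl) hP hc q
    fun O a => ⟨(h O a).1, rfl⟩
  have htest : EfficientFun fun a : Fin (k + 1) → Str => [decide (a 0 = [true])] :=
    efficientFun_decide_eq.comp₂ (efficientFun_proj 0) efficientFun_singleton_true
  refine (hstr.bind htest.efficient id).congr fun O a => ?_
  rw [← (h O a).2, PMF.map_id, PMF.bind_map, PMF.map_comp, ← PMF.bind_pure_comp]
  rfl

theorem EfficientFun.of_isPolyTime_outBit {f : (Fin k → Str) → Bool} (h : IsPolyTime outBit f) :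
    EfficientFun fun a => [f a] := by
  obtain ⟨c, q, hc, hc', h⟩ := h
  exact (Efficient.of_outBit ⟨hc, hc'⟩ hc q h).congr fun _ _ => PMF.pure_map _ _

theorem Efficient.outputsWithin_outBit {F : Oracle → (Fin k → Str) → PMF Bool}
    (h : Efficient P fun O a => (F O a).map fun b => [b]) :
    ∃ (c : Prog) (q : Polynomial ℕ), P c ∧ ∀ (O : Oracle) (a : Fin k → Str),
      c.OutputsWithin outBit O a (q.eval (inputLength a)) (F O a) := by
  obtain ⟨c, q, hc, h⟩ := h
  refine ⟨c, q, hc, fun O a => ⟨(h O a).1.1, ?_⟩⟩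
  have hmap := congrArg (PMF.map fun u : Str => decide (u = [true])) (h O a).1.2
  have hid : ((fun u : Str => decide (u = [true])) ∘ fun b : Bool => [b]) = id := by
    funext b
    cases b <;> rfl
  rw [PMF.map_comp, PMF.map_comp, hid, PMF.map_id] at hmap
  exact hmap

end Conversions

/-! ### The reduction -/

section Pr

theorem Pr_bind_le_add {α : Type} (μ : PMF α) {f g h : α → PMF Bool}
    (hfg : ∀ a, Pr (f a) ≤ Pr (g a) + Pr (h a)) :
    Pr (μ.bind f) ≤ Pr (μ.bind g) + Pr (μ.bind h) := by
  have hne (p q : PMF Bool) : p true + q true ≠ ⊤ :=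
    ENNReal.add_ne_top.2 ⟨p.apply_ne_top _, q.apply_ne_top _⟩
  have hadd (p q : PMF Bool) : Pr p + Pr q = (p true + q true).toReal :=
    (ENNReal.toReal_add (p.apply_ne_top _) (q.apply_ne_top _)).symm
  rw [hadd]
  refine ENNReal.toReal_mono (hne _ _) ?_
  simp only [PMF.bind_apply, ← ENNReal.tsum_add, ← mul_add]
  refine ENNReal.tsum_le_tsum fun a => mul_le_mul_right ?_ _
  exact (ENNReal.toReal_le_toReal ((f a).apply_ne_top _) (hne _ _)).1 (hadd _ _ ▸ hfg a)

theorem Pr_nonneg (p : PMF Bool) : 0 ≤ Pr p := ENNReal.toReal_nonneg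

theorem Pr_le_one (p : PMF Bool) : Pr p ≤ 1 :=
  ENNReal.toReal_mono ENNReal.one_ne_top (PMF.coe_le_one _ _)

theorem Pr_pure (b : Bool) : Pr (PMF.pure b) = if b then 1 else 0 := by
  cases b <;> simp [Pr]

theorem Pr_bind_mono {α : Type} (μ : PMF α) {f g : α → PMF Bool}
    (hfg : ∀ a, Pr (f a) ≤ Pr (g a)) : Pr (μ.bind f) ≤ Pr (μ.bind g) := by
  simpa [Pr_pure] using
    Pr_bind_le_add μ (f := f) (g := g) (h := fun _ => PMF.pure false) (by simpa [Pr_pure] using hfg)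

theorem Pr_map_mono {α : Type} (μ : PMF α) {f g : α → Bool} (hfg : ∀ a, f a = true → g a = true) :
    Pr (μ.map f) ≤ Pr (μ.map g) := by
  rw [← PMF.bind_pure_comp, ← PMF.bind_pure_comp]
  refine Pr_bind_mono μ fun a => ?_
  have := hfg a
  simp only [Function.comp_apply, Pr_pure]
  cases h : f a <;> cases h' : g a <;> simp_all

theorem Pr_map_not (p : PMF Bool) : Pr (p.map not) = 1 - Pr p := by
  have hnot : (p.map not) true = p false := by simp [PMF.map_apply]
  have hsum : p false + p true = 1 := by rw [← p.tsum_coe, tsum_bool]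
  rw [eq_sub_iff_add_eq, Pr, Pr, hnot,
    ← ENNReal.toReal_add (p.apply_ne_top _) (p.apply_ne_top _), hsum, ENNReal.toReal_one]

end Pr

section Advice

/-- A distinguisher may use advice that depends on the index and not only on its size: the advice
for size `n` is taken from an index of size `n` at which the distinguisher wins, if there is one. -/
theorem CompIndist.exists_forall_advice {ι : Type} {size : ι → ℕ} {X Y : ι → PMF (Str × Str)}
    {ε : ℕ → ℝ} (h : CompIndist size X Y ε) {D : Str → Str × Str → PMF Bool}
    (hD : IsPPT outBit fun a : Fin 3 → Str => D (a 0) (a 1, a 2)) {adv : ι → Str}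
    {q : Polynomial ℕ} (hq : ∀ i, (adv i).length ≤ q.eval (size i)) :
    ∃ n₀, ∀ i, n₀ ≤ size i →
      |Pr ((X i).bind (D (adv i))) - Pr ((Y i).bind (D (adv i)))| ≤ ε (size i) := by
  let Wins (i : ι) : Prop :=
    ε (size i) < |Pr ((X i).bind (D (adv i))) - Pr ((Y i).bind (D (adv i)))|
  have hadvice (n : ℕ) : ∃ s : Str, s.length ≤ q.eval n ∧
      ∀ i, size i = n → Wins i → ∃ j, size j = n ∧ Wins j ∧ adv j = s := by
    by_cases hn : ∃ i, size i = n ∧ Wins i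
    · obtain ⟨i, rfl, hi⟩ := hn
      exact ⟨adv i, hq i, fun _ _ _ => ⟨i, rfl, hi, rfl⟩⟩
    · exact ⟨[], Nat.zero_le _, fun i hi hwin => (hn ⟨i, hi, hwin⟩).elim⟩
  choose advice hlen hwin using hadvice
  obtain ⟨n₀, hn₀⟩ := h D hD advice ⟨q, hlen⟩
  refine ⟨n₀, fun i hi => le_of_not_gt fun hlt => ?_⟩
  obtain ⟨j, hj, hjwin, hadv⟩ := hwin _ i rfl hlt
  have := hn₀ _ hi j hj
  rw [← hadv, ← hj] at this
  exact this.not_gt hjwin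

end Advice

section Reduction

theorem NIProtocol.StatSound.compSound {Z : NIProtocol} {L : Set Str} {εs : ℕ → ℝ}
    (h : Z.StatSound L εs) : Z.CompSound L εs :=
  fun Q _ => ⟨0, fun _ _ x hxL hx => hx ▸ h Q x hxL⟩

variable (Z : NIProtocol) (S : Simulator)

/-- The function `f_x`: the verdict on the simulated view, followed by the simulated reference
string. -/
def simFun (x ρ : Str) : Str := Z.V x (S.sim x ρ).1 (S.sim x ρ).2 :: (S.sim x ρ).1

/-- Is `ρ` a preimage of `y` under `f_x` among the coins of the simulator? -/
def isPreimage (x y ρ : Str) : Bool := decide (ρ.length = S.ℓ x.length ∧ simFun Z S x ρ = y)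

/-- The algorithm `R` of the theorem: sample a reference string `r`, ask the oracle for simulator
coins that lead to `r` and an accepting proof, and check the answer. -/
noncomputable def reduction (O : Oracle) (x : Str) : PMF Bool :=
  (Z.Gen (unary x.length)).bind fun r => (O x (true :: r)).map (isPreimage Z S x (true :: r))

/-- The prover that breaks soundness if the reduction accepts too often: given the reference string
`r`, send the proof simulated with coins that the inverter `A` finds for `r`. -/
noncomputable def cheatingProver (A : Str → Str → PMF Str) (x r : Str) : PMF Str :=
  (A x (true :: r)).map fun ρ => (S.sim x ρ).2

/-- The distinguisher for the zero-knowledge property: does `A` invert `f_x` at the value given by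
the view `v`? -/
noncomputable def inversionTest (A : Str → Str → PMF Str) (x : Str) (v : Str × Str) : PMF Bool :=
  (A x (Z.V x v.1 v.2 :: v.1)).map (isPreimage Z S x (Z.V x v.1 v.2 :: v.1))

theorem length_unary (n : ℕ) : (unary n).length = n := List.length_replicate

theorem unary_injective : Function.Injective unary := List.replicate_left_injective true

theorem efficientFun_simFun :
    EfficientFun fun a : Fin 2 → Str => simFun Z S (a 0) (a 1) := by
  have hr := EfficientFun.fst_of_isPolyTime S.sim_polyTime
  have hπ := EfficientFun.snd_of_isPolyTime S.sim_polyTime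
  exact efficientFun_headD_cons.comp₂
    ((EfficientFun.of_isPolyTime_outBit Z.v_polyTime).comp₃ (efficientFun_proj 0) hr hπ) hr

theorem EfficientFun.true_cons {m : ℕ} {f : (Fin m → Str) → Str} (hf : EfficientFun f) :
    EfficientFun fun a => true :: f a :=
  efficientFun_headD_cons.comp₂ efficientFun_singleton_true hf

theorem efficientFun_isPreimage :
    EfficientFun fun a : Fin 3 → Str => [isPreimage Z S (a 0) (a 1) (a 2)] := by
  have hℓ : EfficientFun fun a : Fin 3 → Str => unary (S.ℓ (a 0).length) :=
    (EfficientFun.of_isPolyTime S.ℓ_polyTime).comp₁ (efficientFun_proj 0)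
  have hlen : EfficientFun fun a : Fin 3 → Str =>
      [decide (unary (a 2).length = unary (S.ℓ (a 0).length))] :=
    efficientFun_decide_eq.comp₂ (efficientFun_unary_length.comp₁ (efficientFun_proj 2)) hℓ
  have hval : EfficientFun fun a : Fin 3 → Str => simFun Z S (a 0) (a 2) :=
    (efficientFun_simFun Z S).comp₂ (efficientFun_proj 0) (efficientFun_proj 2)
  refine (efficientFun_decide_eq.comp₂ (efficientFun_headD_cons.comp₂ hlen hval)
    (efficientFun_proj 1).true_cons).congr fun _ a => ?_
  simp [isPreimage, unary_injective.eq_iff]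

theorem isPreimage_take (x y ρ : Str) :
    isPreimage Z S x y (ρ.take (S.ℓ x.length + 1)) = isPreimage Z S x y ρ := by
  rcases le_or_gt ρ.length (S.ℓ x.length + 1) with h | h
  · rw [List.take_of_length_le h]
  · have htake : (ρ.take (S.ℓ x.length + 1)).length ≠ S.ℓ x.length := by
      rw [List.length_take]
      omega
    have hlen : ρ.length ≠ S.ℓ x.length := by omega
    simp only [isPreimage, htake, hlen, false_and]

theorem isPolyTimeOracleAlg_reduction : IsPolyTimeOracleAlg (reduction Z S) := by
  have hGen : Efficient OracleAided fun _ (a : Fin 1 → Str) => Z.Gen (unary (a 0).length) :=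
    ((Efficient.of_isPPT Z.gen_ppt).mono (P' := OracleAided) fun _ _ => trivial).comp₁
      (efficientFun_unary_length.comp₁ (efficientFun_proj 0))
  have hℓ : EfficientFun fun a : Fin 2 → Str => unary (S.ℓ (a 1).length) :=
    (EfficientFun.of_isPolyTime S.ℓ_polyTime).comp₁ (efficientFun_proj 1)
  have hquery : Efficient OracleAided fun O (a : Fin 2 → Str) =>
      (O (a 1) (true :: a 0)).map (List.take (true :: unary (S.ℓ (a 1).length)).length) :=
    efficient_query_take.comp₃ hℓ.true_cons (efficientFun_proj 1) (efficientFun_proj 0).true_cons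
  have htest : EfficientFun fun a : Fin 3 → Str => [isPreimage Z S (a 2) (true :: a 1) (a 0)] :=
    (efficientFun_isPreimage Z S).comp₃ (efficientFun_proj 2) (efficientFun_proj 1).true_cons
      (efficientFun_proj 0)
  have h : Efficient OracleAided fun O (a : Fin 1 → Str) =>
      (reduction Z S O (a 0)).map fun b => [b] :=
    (hGen.bind (hquery.bind htest.efficient id) id).congr fun O a => by
      simp only [reduction, PMF.map_bind, PMF.map_comp]
      refine congrArg _ (funext fun r => ?_)
      rw [PMF.bind_map, ← PMF.bind_pure_comp]
      refine congrArg _ (funext fun ρ => congrArg (fun b => PMF.pure [b]) ?_)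
      refine Eq.trans ?_ (isPreimage_take Z S (a 0) (true :: r) ρ)
      rw [← length_unary (S.ℓ (a 0).length)]
      rfl
  obtain ⟨c, q, -, hc⟩ := h.outputsWithin_outBit
  exact ⟨c, q, fun O x => by simpa [inputLength] using hc O ![x]⟩

theorem isPPT_cheatingProver {A : Str → Str → PMF Str}
    (hA : IsPPT outStr fun a : Fin 2 → Str => A (a 0) (a 1)) :
    IsPPT outStr fun a : Fin 2 → Str => cheatingProver S A (a 0) (a 1) := by
  have hinv : Efficient Prog.OracleFree fun _ (a : Fin 2 → Str) => A (a 0) (true :: a 1) :=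
    (Efficient.of_isPPT hA).comp₂ (efficientFun_proj 0) (efficientFun_proj 1).true_cons
  have hsim : EfficientFun fun a : Fin 3 → Str => (S.sim (a 1) (a 0)).2 :=
    (EfficientFun.snd_of_isPolyTime S.sim_polyTime).comp₂ (efficientFun_proj 1)
      (efficientFun_proj 0)
  refine Efficient.isPPT ((hinv.bind hsim.efficient id).congr fun O a => ?_)
  rw [cheatingProver, ← PMF.bind_pure_comp]
  rfl

theorem isPPT_inversionTest {A : Str → Str → PMF Str}
    (hA : IsPPT outStr fun a : Fin 2 → Str => A (a 0) (a 1)) :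
    IsPPT outBit fun a : Fin 3 → Str => inversionTest Z S A (a 0) (a 1, a 2) := by
  have hval : EfficientFun fun a : Fin 3 → Str => Z.V (a 0) (a 1) (a 2) :: a 1 :=
    efficientFun_headD_cons.comp₂ (EfficientFun.of_isPolyTime_outBit Z.v_polyTime)
      (efficientFun_proj 1)
  have hinv : Efficient Prog.OracleFree fun _ (a : Fin 3 → Str) =>
      A (a 0) (Z.V (a 0) (a 1) (a 2) :: a 1) :=
    (Efficient.of_isPPT hA).comp₂ (efficientFun_proj 0) hval
  have htest : EfficientFun fun a : Fin 4 → Str =>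
      [isPreimage Z S (a 1) (Z.V (a 1) (a 2) (a 3) :: a 2) (a 0)] :=
    (efficientFun_isPreimage Z S).comp₃ (efficientFun_proj 1) (hval.reindex Fin.succ)
      (efficientFun_proj 0)
  refine Efficient.outputsWithin_outBit (F := fun _ a => inversionTest Z S A (a 0) (a 1, a 2))
    ((hinv.bind htest.efficient id).congr fun O a => ?_)
  rw [inversionTest, PMF.map_comp, ← PMF.bind_pure_comp]
  rfl

theorem Pr_reduction_le_verdict (A : Str → Str → PMF Str) (x : Str) :
    Pr (reduction Z S A x) ≤ Pr (Z.verdict (cheatingProver S A) x) := by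
  refine Pr_bind_mono _ fun r => ?_
  rw [cheatingProver, PMF.map_comp]
  refine Pr_map_mono _ fun ρ h => ?_
  obtain ⟨-, h⟩ := of_decide_eq_true h
  obtain ⟨hV, hr⟩ := List.cons_eq_cons.1 h
  simpa [hr] using hV

theorem inverts_simFun (A : Str → Str → PMF Str) (x : Str) :
    inverts (simFun Z S) (S.ℓ x.length) A x = (S.dist x).bind (inversionTest Z S A x) := by
  rw [Simulator.dist, PMF.bind_map]
  rfl

theorem Pr_inversionTest_view_le (A : Str → Str → PMF Str) (x w : Str) :
    Pr ((Z.view x w).bind (inversionTest Z S A x)) ≤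
      Pr (reduction Z S A x) + (1 - Pr (Z.verdict (fun x r => Z.P x w r) x)) := by
  have haccept : (Z.view x w).bind
      (fun v => (A x (true :: v.1)).map (isPreimage Z S x (true :: v.1))) = reduction Z S A x := by
    simp only [NIProtocol.view, reduction, PMF.bind_bind, PMF.bind_map, Function.comp_def,
      PMF.bind_const]
  have hreject : (Z.view x w).bind (fun v => PMF.pure (!Z.V x v.1 v.2)) =
      (Z.verdict (fun x r => Z.P x w r) x).map not := by
    simp only [NIProtocol.view, NIProtocol.verdict, PMF.bind_bind, PMF.map_bind, PMF.map_comp,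
      PMF.bind_map]
    simp only [← PMF.bind_pure_comp, Function.comp_def]
  rw [← Pr_map_not, ← hreject, ← haccept]
  refine Pr_bind_le_add _ fun v => ?_
  unfold inversionTest
  cases Z.V x v.1 v.2
  · simpa [Pr_pure] using (Pr_le_one _).trans (le_add_of_nonneg_left (Pr_nonneg _))
  · simp [Pr_pure]

end Reduction

end WeakZK

theorem lemma3p1_general
    (εc εs εz : ℕ → ℝ) (L : Set Str) (Rel : Str → Str → Bool) (hL : ∀ x ∈ L, ∃ w, Rel x w = true)
    (Z : NIProtocol) (hc : Z.Complete Rel εc) (hs : Z.CompSound L εs)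
    (S : Simulator) (hS : S.ZeroKnowledge Z Rel εz) :
    ∃ (R : Oracle → Str → PMF Bool) (F : Str → Str → Str),
      IsPolyTimeOracleAlg R ∧
      IsPolyTime outStr (fun a : Fin 2 → Str => F (a 0) (a 1)) ∧
      (∀ x ρ, F x ρ = Z.V x (S.sim x ρ).1 (S.sim x ρ).2 :: (S.sim x ρ).1) ∧
      ∀ A : Str → Str → PMF Str, IsPPT outStr (fun a : Fin 2 → Str => A (a 0) (a 1)) →
        ∃ N : ℕ, ∀ n ≥ N, ∀ x : Str, x.length = n →
          (x ∈ L → Pr (inverts F (S.ℓ n) A x) - εc n - εz n ≤ Pr (R A x)) ∧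
          (x ∉ L → Pr (R A x) ≤ εs n) := by
  refine ⟨reduction Z S, simFun Z S, isPolyTimeOracleAlg_reduction Z S,
    (efficientFun_simFun Z S).isPolyTime, fun _ _ => rfl, fun A hA => ?_⟩
  obtain ⟨N₁, hsound⟩ := hs _ (isPPT_cheatingProver S hA)
  obtain ⟨N₂, hindist⟩ := hS.exists_forall_advice (isPPT_inversionTest Z S hA)
    (adv := fun i => i.1.1) (q := Polynomial.X) fun i => by simp
  refine ⟨max N₁ N₂, ?_⟩
  rintro _ hn x rfl
  refine ⟨fun hx => ?_, fun hx => (Pr_reduction_le_verdict Z S A x).trans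
    (hsound _ ((le_max_left _ _).trans hn) x hx rfl)⟩
  obtain ⟨w, hw⟩ := hL x hx
  have hview := (abs_le.1 (hindist ⟨(x, w), hw⟩ ((le_max_right _ _).trans hn))).2
  have htest := Pr_inversionTest_view_le Z S A x w
  have hcomplete := hc x w hw
  rw [inverts_simFun]
  dsimp only at hview
  linarith

theorem lemma3p1
    (εc εs εz : ℕ → Set.Icc (0 : ℝ) 1)
    (L : Set Str) (Rel : Str → Str → Bool) (hL : IsNPRelation L Rel)
    (Z : NIProtocol)
    (hZ : IsNIZKProof Z L Rel (fun n => εc n) (fun n => εs n) (fun n => εz n) ∨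
      IsNIZKArgument Z L Rel (fun n => εc n) (fun n => εs n) (fun n => εz n))
    (S : Simulator) (hS : S.ZeroKnowledge Z Rel (fun n => εz n)) :
    ∃ (R : Oracle → Str → PMF Bool) (F : Str → Str → Str),
      IsPolyTimeOracleAlg R ∧
      IsPolyTime outStr (fun a : Fin 2 → Str => F (a 0) (a 1)) ∧
      -- `f_x(ρ)` is the pair `(r, V(x; r, π))` with `(r, π) = Sim(x; ρ)`, written as a string with
      -- the verdict bit first
      (∀ x ρ, F x ρ = Z.V x (S.sim x ρ).1 (S.sim x ρ).2 :: (S.sim x ρ).1) ∧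
      ∀ A : Str → Str → PMF Str, IsPPT outStr (fun a : Fin 2 → Str => A (a 0) (a 1)) →
        ∀ p : Polynomial ℝ, ∃ N : ℕ, ∀ n ≥ N, ∀ x : Str, x.length = n →
          (x ∈ L → 1 - 1 / p.eval (n : ℝ) ≤ Pr (inverts F (S.ℓ n) A x) →
            1 - (εc n : ℝ) - εz n - 1 / p.eval (n : ℝ) ≤ Pr (R A x)) ∧
          (x ∉ L → Pr (R A x) ≤ εs n) := by
  obtain ⟨R, F, hR, hF, hFx, h⟩ := lemma3p1_general _ _ _ L Rel (fun x => (hL.2.2 x).1) Z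
    (hZ.elim (·.1) (·.2.1)) (hZ.elim (·.2.1.compSound) (·.2.2.1)) S hS
  refine ⟨R, F, hR, hF, hFx, fun A hA p => ?_⟩
  obtain ⟨N, hN⟩ := h A hA
  refine ⟨N, fun n hn x hx => ⟨fun hxL hinv => ?_, (hN n hn x hx).2⟩⟩
  have := (hN n hn x hx).1 hxL
  linarith
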